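/- **Setting.** Let $\mathcal A$ be a finite set of $n$ agents and $\mathcal G$ a finite set of items, and for each $i\in\mathcal A$ let $v_i:2^{\mathcal G}\to\mathbb R_{\ge 0}$ be monotone and submodular. For $x\in[0,1]^{\mathcal G}$ let $$V_i(x)=\sum_{S\subseteq\mathcal G}v_i(S)\prod_{j\in S}x_j\prod_{j\notin S}(1-x_j)$$ be the multilinear extension of $v_i$. A *matching* is an injective map defined on all of $\mathcal A$. Let $\tau:\mathcal A\to\mathcal G$ be a matching maximizing $\prod_{i}v_i(\{\tau(i)\})$, and assume $v_i(\{\tau(i)\})>0$ for all $i$. Put $\mathcal H=\tau(\mathcal A)$, $\mathcal G'=\mathcal G\setminus\mathcal H$, $\mathcal A'=\{i\in\mathcal A: v_i(\mathcal G')>0\}$. Let $OPT$ be the maximum of $\big(\prod_{i\in\mathcal A}V_i(x_i)\big)^{1/n}$ over all $x\in\mathbb R_{\ge0}^{\mathcal A\times\mathcal G}$ with $\sum_i x_{ij}\le 1$ for every $j\in\mathcal G$ and $x_{ij}\in\{0,1\}$ for all $i\in\mathcal A$, $j\in\mathcal H$. **Iterated continuous greedy.** Call $z\in\mathbb R_{\ge0}^{\mathcal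 A\times\mathcal G}$ *feasible* if $z_{ij}=0$ unless $i\in\mathcal A'$ and $j\in\mathcal G'$, and $\sum_{i} z_{ij}\le1$ for every $j$. Let $y^{(0)}_{ij}=\frac1n$ for $i\in\mathcal A'$, $j\in\mathcal G'$, and $y^{(0)}_{ij}=0$ otherwise. For $r=1,2,\dots$, start from $y(\tfrac12)=\tfrac12y^{(r-1)}$ and follow $\frac{d}{dt}y(t)=z(t)$ for $t\in[\tfrac12,1]$ (in integral form), where $z(t)$ is a feasible point maximizing $\sum_{i\in\mathcal A'}\frac{z_i\cdot\nabla V_i(y_i(t))}{V_i(y_i(t))}$; put $y^{(r)}=y(1)$. Continue as long as $\frac1n\sum_{i\in\mathcal A'}\log V_i(y^{(r)}_i)\ge\frac1n\sum_{i\in\mathcal A'}\log V_i(y^{(r-1)}_i)+\frac18$; otherwise stop and output $y=y^{(r)}$. **Restricted randomized rounding with parameter $c>0$.** For $L\subseteq\mathcal G$ let $y_i^{(L)}$ be $y_i$ with the coordinates outside $L$ set to $0$. For each $i\in\mathcal A'$ let $L_i$ be obtained greedily: start with $L_i=\emptyset$ and, as long as $\sum_{j\in L_i}y_{ij}<c$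 and $\mathcal G'\setminus L_i\ne\emptyset$, add to $L_i$ an item $j\in\mathcal G'\setminus L_i$ maximizing $V_i(y_i^{(L_i)}+\mathbf 1_j)-V_i(y_i^{(L_i)})$ (ties broken arbitrarily). Independently for each item $j\in\mathcal G'$, let $Z_j=i$ with probability $y_{ij}$ for each $i\in\mathcal A'$, and let $Z_j$ be no agent with probability $1-\sum_{i\in\mathcal A'} y_{ij}$. Put $S_i=\{j\in\mathcal G'\setminus L_i: Z_j=i\}$ for $i\in\mathcal A'$, and $S_i=\emptyset$ for $i\notin\mathcal A'$. **Lemma.** There is an absolute constant $p>0$ (independent of the instance, of $y$, of $c$ and of the sets $L_i$) such that for every instance as above, every output $y$ of iterated continuous greedy, every $c>0$ and every outcome $(L_i)_{i\in\mathcal A'}$ of the greedy choice of large items, with probability at least $p$ there is a matching $\rho:\mathcal A\to\mathcal H$ with $$\Big(\prod_{i\in\mathcal A}v_i(S_i\cup\{\rho(i)\})\Big)^{1/n}\ \ge\ \frac{OPT}{(7+12/c)(c+3)(c+4)}.$$ In particular, for $c=1$, with probability at least $p$ there is a matching $\rho:\mathcal A\to\mathcal H$ for which the left-hand side is at least $OPT/380$.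 -/

import Mathlib

open scoped BigOperators

noncomputable section

namespace NashWelfare

variable {A G : Type*} [Fintype A] [Fintype G] [DecidableEq A] [DecidableEq G]

/-- `w : 2^G → ℝ₊` is a (nonnegative) monotone submodular set function. -/
structure IsMonotoneSubmodular (w : Finset G → ℝ) : Prop where
  nonneg : ∀ S, 0 ≤ w S
  mono : ∀ S T, S ⊆ T → w S ≤ w T
  submodular : ∀ S T, w (S ∩ T) + w (S ∪ T) ≤ w S + w T

/-- The multilinear extension
`W(x) = ∑_S w(S) ∏_{j ∈ S} x_j ∏_{j ∉ S} (1 - x_j)` of a set function `w`. -/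
def multilinearExt (w : Finset G → ℝ) (x : G → ℝ) : ℝ :=
  ∑ S : Finset G, w S * (∏ j ∈ S, x j) * ∏ j ∈ Sᶜ, (1 - x j)

/-- The geometric mean `(∏_{i ∈ A} u_i)^{1/n}`, where `n = |A|`. -/
def geomMean (u : A → ℝ) : ℝ := (∏ i, u i) ^ (1 / (Fintype.card A : ℝ))

/-! ### The initial matching and the mixed multilinear relaxation -/

/-- `τ : A → G` is a matching (an injective map) maximizing `∏_i v_i(τ(i))`. -/
def IsOptimalMatching (v : A → Finset G → ℝ) (τ : A → G) : Prop :=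
  Function.Injective τ ∧
    ∀ τ' : A → G, Function.Injective τ' → ∏ i, v i {τ' i} ≤ ∏ i, v i {τ i}

/-- `H = τ(A)`, the items used by the matching `τ`. -/
def matchedItems (τ : A → G) : Finset G := Finset.univ.image τ

/-- `G' = G \ H`, the items not used by the matching `τ`. -/
def remainingItems (τ : A → G) : Finset G := (matchedItems τ)ᶜ

/-- `A' = {i : v_i(G') > 0}`. -/
def activeAgents (v : A → Finset G → ℝ) (τ : A → G) : Finset A :=
  Finset.univ.filter fun i => 0 < v i (remainingItems τ)

/-- Feasible solutions of the mixed multilinear relaxation: every item is allocated at most once,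
the items of `H` integrally. -/
structure MixedFeasible (H : Finset G) (x : A → G → ℝ) : Prop where
  sum_le_one : ∀ j, ∑ i, x i j ≤ 1
  nonneg : ∀ i j, 0 ≤ x i j
  integral : ∀ i, ∀ j ∈ H, x i j = 0 ∨ x i j = 1

/-- `OPT`: the maximum of `(∏_i V_i(x_i))^{1/n}` over all feasible solutions `x` of the mixed
multilinear relaxation. -/
def mixedOPT (v : A → Finset G → ℝ) (H : Finset G) : ℝ :=
  sSup {r | ∃ x : A → G → ℝ, MixedFeasible H x ∧
    r = geomMean fun i => multilinearExt (v i) (x i)}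

/-! ### The iterated continuous greedy algorithm -/

/-- Feasible solutions of the log-multilinear program on the agents `A'` and the items `G'`, as
matrices over `A × G` which vanish outside `A' × G'`. -/
structure LogFeasible (A' : Finset A) (G' : Finset G) (y : A → G → ℝ) : Prop where
  nonneg : ∀ i j, 0 ≤ y i j
  sum_le_one : ∀ j, ∑ i ∈ A', y i j ≤ 1
  eq_zero_of_agent : ∀ i j, i ∉ A' → y i j = 0
  eq_zero_of_item : ∀ i j, j ∉ G' → y i j = 0

/-- The objective `(1/n) ∑_{i ∈ A'} log V_i(y_i)`, where `n = |A|`. -/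
def logObjective (v : A → Finset G → ℝ) (A' : Finset A) (y : A → G → ℝ) : ℝ :=
  1 / (Fintype.card A : ℝ) * ∑ i ∈ A', Real.log (multilinearExt (v i) (y i))

/-- The linear objective `∑_{i ∈ A'} (z_i ⬝ ∇V_i(y_i)) / V_i(y_i)` for the direction `z` at `y`. -/
def greedyObjective (v : A → Finset G → ℝ) (A' : Finset A) (y z : A → G → ℝ) : ℝ :=
  ∑ i ∈ A', fderiv ℝ (multilinearExt (v i)) (y i) (z i) / multilinearExt (v i) (y i)

/-- `y₁` is a possible result of one run of continuous greedy started from `y₀`: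
`y(1/2) = y₀ / 2`, `dy/dt = z(t)` on `[1/2, 1]` where at each time `z(t)` is a feasible solution
maximizing the linear objective at `y(t)`, and `y₁ = y(1)`. As `z` need not be continuous, the
differential equation is read in its integral form. -/
def ContinuousGreedyRun (v : A → Finset G → ℝ) (A' : Finset A) (G' : Finset G)
    (y₀ y₁ : A → G → ℝ) : Prop :=
  ∃ y z : ℝ → A → G → ℝ,
    (∀ t ∈ Set.Icc (1 / 2 : ℝ) 1, LogFeasible A' G' (z t) ∧
      ∀ w, LogFeasible A' G' w → greedyObjective v A' (y t) w ≤ greedyObjective v A' (y t) (z t)) ∧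
    (∀ i j, IntervalIntegrable (fun s => z s i j) MeasureTheory.volume (1 / 2) 1) ∧
    (∀ t ∈ Set.Icc (1 / 2 : ℝ) 1, ∀ i j,
      y t i j = 1 / 2 * y₀ i j + ∫ s in (1 / 2 : ℝ)..t, z s i j) ∧
    y₁ = y 1

/-- The starting point: `1/n` on `A' × G'`, and `0` elsewhere. -/
def initialSolution (A' : Finset A) (G' : Finset G) : A → G → ℝ :=
  fun i j => if i ∈ A' ∧ j ∈ G' then 1 / (Fintype.card A : ℝ) else 0

/-- `y` is a possible output of the iterated continuous greedy algorithm: continuous greedy is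
iterated as long as the last run improved the objective by at least `1/8`, and `y` is the result
of the first run that did not. -/
def IteratedContinuousGreedy (v : A → Finset G → ℝ) (A' : Finset A) (G' : Finset G)
    (y : A → G → ℝ) : Prop :=
  ∃ (r : ℕ) (Y : ℕ → A → G → ℝ),
    Y 0 = initialSolution A' G' ∧
    (∀ k ≤ r, ContinuousGreedyRun v A' G' (Y k) (Y (k + 1))) ∧
    (∀ k < r, logObjective v A' (Y k) + 1 / 8 ≤ logObjective v A' (Y (k + 1))) ∧
    logObjective v A' (Y (r + 1)) < logObjective v A' (Y r) + 1 / 8 ∧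
    y = Y (r + 1)

/-! ### Large items and restricted randomized rounding -/

/-- `y^{(S)}`: all coordinates of `y` outside of `S` are set to `0`. -/
def restrictTo (S : Finset G) (y : G → ℝ) : G → ℝ := fun j => if j ∈ S then y j else 0

/-- The marginal value `W(y^{(L)} + 1_j) - W(y^{(L)})`. -/
def marginal (w : Finset G → ℝ) (y : G → ℝ) (L : Finset G) (j : G) : ℝ :=
  multilinearExt w (restrictTo L y + Pi.single j 1) - multilinearExt w (restrictTo L y)

/-- The sets `L^{(0)} ⊆ L^{(1)} ⊆ ⋯` that can occur during the search for large items: as long as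
the total fractional mass is less than `c` and some item of `G'` is left, an item of `G'` with
the largest marginal value is added (ties are broken arbitrarily). -/
inductive LargeSetStage (w : Finset G → ℝ) (G' : Finset G) (y : G → ℝ) (c : ℝ) :
    Finset G → Prop
  | start : LargeSetStage w G' y c ∅
  | step (L : Finset G) (j : G) : LargeSetStage w G' y c L → ∑ k ∈ L, y k < c → j ∈ G' \ L →
      (∀ k ∈ G' \ L, marginal w y L k ≤ marginal w y L j) →
      LargeSetStage w G' y c (insert j L)

/-- `L` is a possible output of the search for large items: a stage at which it stops. -/
def IsLargeSet (w : Finset G → ℝ) (G' : Finset G) (y : G → ℝ) (c : ℝ) (L : Finset G) : Prop :=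
  LargeSetStage w G' y c L ∧ ¬ (∑ k ∈ L, y k < c ∧ (G' \ L).Nonempty)

/-- The distribution of `Z_j`: `Z_j = i` with probability `y_{ij}`, and `Z_j` is no agent
(`none`) with the remaining probability. -/
def assignWeight (y : A → G → ℝ) (j : G) : Option A → ℝ
  | some i => y i j
  | none => 1 - ∑ i, y i j

open Classical in
/-- The probability of the event `E` when the `Z_j`, `j ∈ G`, are independent. -/
def roundingProb (y : A → G → ℝ) (E : (G → Option A) → Prop) : ℝ :=
  ∑ Z : G → Option A with E Z, ∏ j, assignWeight y j (Z j)

/-- `S_i = {j ∈ G' \ L_i : Z_j = i}` for `i ∈ A'`, and `S_i = ∅` for the other agents. -/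
def smallItems (A' : Finset A) (G' : Finset G) (L : A → Finset G) (Z : G → Option A) (i : A) :
    Finset G :=
  if i ∈ A' then (G' \ L i).filter fun j => Z j = some i else ∅

/-- There is a matching `ρ : A → H` with `(∏_i v_i(S_i + ρ(i)))^{1/n} ≥ b`. -/
def ExistsMatchingAbove (v : A → Finset G → ℝ) (H : Finset G) (S : A → Finset G) (b : ℝ) : Prop :=
  ∃ ρ : A → G, Function.Injective ρ ∧ (∀ i, ρ i ∈ H) ∧
    b ≤ geomMean fun i => v i (insert (ρ i) (S i))

end NashWelfare

end

open NashWelfare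

/-!
The proof compares an arbitrary feasible `x` of the mixed relaxation with the result of the rounding
step in three stages, and loses a factor in each one; the probability bound is `p = 1/2`.

*Continuous greedy.* The multilinear extension `V` of a monotone submodular function satisfies
`V(x) - V(y) ≤ x ⬝ ∇V(y)`. Hence `∑_i log V_i` grows along a run of continuous greedy at least at the
rate `∑_i V_i(x_i) / V_i(y_i) - |A'|`, for every feasible `x` (`ContinuousGreedyRun.gain`, by the
fundamental theorem of calculus for Lipschitz functions). The last run gains less than `n / 8` over
its starting point before halving, and halving loses at most `log 2` per agent, so that
`∑_i V_i(x_i) / V_i(y_i) ≤ 3 n` (`IteratedContinuousGreedy.sum_ratio_le`).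

*Rounding.* Let `g_i` be the largest value of a single item of `G'` for agent `i` (or `v_i(∅)`, if
this is larger). The large items have fractional mass at most `c + 1`, so they contribute at most
`(c + 1) g_i` to `V_i(y_i)`. If they contribute less than half, the small ones matter: their marginal
values with respect to the large ones are at most `V_i(y_i^{(L_i)}) / c`, by the greedy choice, and
the variance of a submodular function of independent items is at most the largest marginal value
times the mean (`IsMonotoneSubmodular.variance_le`). So `v_i(S_i)` is unlikely to be small, and the
expectation of `V_i(y_i) / max(v_i(S_i), g_i)` is at most `D = 14 + 8/c + 2c` (`ext_ratio_le`). By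
Markov's inequality the average of these ratios is at most `2 D` with probability at least `1/2`.

*Rematching.* Let `π(i)` be the best item of `H` that `x` gives to agent `i`, if there is one. For some
matching `ρ` into `H`, the product of the values `v_i(S_i ∪ {ρ(i)})` is at least that of
`max(v_i(π(i)), v_i(S_i), g_i)`
(`exists_matching_prod_le`): the value `g_i` of a single item outside `H` is made up for by the
optimality of `τ`, along alternating paths of `π` and `τ`.

If `x` gives `k_i` items of `H` to agent `i`, then
`V_i(x_i) ≤ k_i v_i(π(i)) + V_i(x_i restricted to G')`, and the inequality of the means turns the
bounds on averages into bounds on geometric means (`exists_matching_geomMean_ge`). The total loss is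
`4 (1 + 2 D)`, which is less than `(7 + 12/c)(c + 3)(c + 4)` for all `c`, and less than `380` for
`c = 1`.
-/

open scoped BigOperators
noncomputable section
namespace NashWelfare
open Finset
set_option linter.unusedSectionVars false

variable {A G : Type*} [Fintype A] [Fintype G] [DecidableEq A] [DecidableEq G]

/-! ### Product distributions and the multilinear extension -/

/-- The expectation of `F Z`, where the coordinates `Z j` are independent and `Z j = b` with
probability `q j b`. -/
def prodExp {β : Type*} [Fintype β] (q : G → β → ℝ) (F : (G → β) → ℝ) : ℝ :=
  ∑ Z : G → β, (∏ j, q j (Z j)) * F Z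

lemma prodExp_mono {β : Type*} [Fintype β] {q : G → β → ℝ} (hq : ∀ j b, 0 ≤ q j b)
    {F F' : (G → β) → ℝ} (h : ∀ Z, F Z ≤ F' Z) : prodExp q F ≤ prodExp q F' :=
  sum_le_sum fun Z _ => mul_le_mul_of_nonneg_left (h Z) (prod_nonneg fun j _ => hq j _)

lemma prodExp_add {β : Type*} [Fintype β] (q : G → β → ℝ) (F F' : (G → β) → ℝ) :
    prodExp q (fun Z => F Z + F' Z) = prodExp q F + prodExp q F' := by
  simp only [prodExp, mul_add, sum_add_distrib]

lemma prodExp_const_mul {β : Type*} [Fintype β] (q : G → β → ℝ) (a : ℝ) (F : (G → β) → ℝ) :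
    prodExp q (fun Z => a * F Z) = a * prodExp q F := by
  simp only [prodExp, mul_sum, mul_left_comm]

lemma prodExp_sum {β ι : Type*} [Fintype β] (q : G → β → ℝ) (s : Finset ι)
    (F : ι → (G → β) → ℝ) :
    prodExp q (fun Z => ∑ i ∈ s, F i Z) = ∑ i ∈ s, prodExp q (F i) := by
  simp only [prodExp, mul_sum]
  exact sum_comm

lemma prodExp_const {β : Type*} [Fintype β] {q : G → β → ℝ} (hq : ∀ j, ∑ b, q j b = 1) (a : ℝ) :
    prodExp q (fun _ => a) = a := by
  classical
  rw [prodExp, ← sum_mul, ← Fintype.prod_sum]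
  simp [hq]

/-- The random set of those `j` for which `Z j` satisfies `P j` contains its elements independently
of each other, so that it has the distribution defining the multilinear extension. -/
lemma prodExp_filter {β : Type*} [Fintype β] {q : G → β → ℝ} (hq : ∀ j, ∑ b, q j b = 1)
    (P : G → β → Prop) [∀ j b, Decidable (P j b)] (f : Finset G → ℝ) :
    prodExp q (fun Z => f (univ.filter fun j => P j (Z j))) =
      multilinearExt f (fun j => ∑ b with P j b, q j b) := by
  classical
  unfold prodExp multilinearExt
  rw [← sum_fiberwise univ (fun Z : G → β => univ.filter fun j => P j (Z j))]
  refine sum_congr rfl fun S _ => ?_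
  have h1 : ∀ j, 1 - ∑ b with P j b, q j b = ∑ b with ¬ P j b, q j b := fun j => by
    rw [← hq j, ← sum_filter_add_sum_filter_not univ (P j)]; ring
  have h2 : (∏ j ∈ S, ∑ b with P j b, q j b) * ∏ j ∈ Sᶜ, (1 - ∑ b with P j b, q j b) =
      ∏ j, ∑ b with (P j b ↔ j ∈ S), q j b := by
    rw [← prod_mul_prod_compl S]
    congr 1
    · exact prod_congr rfl fun j hj => by simp [hj]
    · refine prod_congr rfl fun j hj => ?_
      rw [h1]
      simp [mem_compl.1 hj]
  rw [mul_assoc, h2, prod_univ_sum, mul_sum]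
  have h3 : (univ.filter fun Z : G → β => (univ.filter fun j => P j (Z j)) = S) =
      Fintype.piFinset fun j => univ.filter fun b => (P j b ↔ j ∈ S) := by
    ext Z
    simp [Finset.ext_iff]
  rw [h3]
  refine sum_congr rfl fun Z hZ => ?_
  rw [← h3, mem_filter] at hZ
  beta_reduce
  rw [hZ.2, mul_comm]

lemma multilinearExt_congr_arg {f : Finset G → ℝ} {x y : G → ℝ} (h : ∀ j, x j = y j) :
    multilinearExt f x = multilinearExt f y := by rw [funext h]

lemma multilinearExt_add (f g : Finset G → ℝ) (x : G → ℝ) :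
    multilinearExt (fun S => f S + g S) x = multilinearExt f x + multilinearExt g x := by
  simp only [multilinearExt, add_mul, sum_add_distrib]

lemma multilinearExt_const_mul (a : ℝ) (f : Finset G → ℝ) (x : G → ℝ) :
    multilinearExt (fun S => a * f S) x = a * multilinearExt f x := by
  simp only [multilinearExt, mul_sum, mul_assoc]

lemma multilinearExt_sub (f g : Finset G → ℝ) (x : G → ℝ) :
    multilinearExt (fun S => f S - g S) x = multilinearExt f x - multilinearExt g x := by
  simp only [multilinearExt, sub_mul, sum_sub_distrib]

lemma multilinearExt_sum {ι : Type*} (s : Finset ι) (f : ι → Finset G → ℝ) (x : G → ℝ) :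
    multilinearExt (fun S => ∑ i ∈ s, f i S) x = ∑ i ∈ s, multilinearExt (f i) x := by
  simp only [multilinearExt, sum_mul]
  exact sum_comm

lemma multilinearExt_mono_fun {f g : Finset G → ℝ} {x : G → ℝ} (h0 : ∀ j, 0 ≤ x j)
    (h1 : ∀ j, x j ≤ 1) (h : ∀ S, f S ≤ g S) : multilinearExt f x ≤ multilinearExt g x :=
  sum_le_sum fun S _ => mul_le_mul_of_nonneg_right (mul_le_mul_of_nonneg_right (h S)
    (prod_nonneg fun j _ => h0 j)) (prod_nonneg fun j _ => sub_nonneg.2 (h1 j))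

/-- The weights `x j`, `1 - x j` of an independent random subset of `G`. -/
def bernoulliWeight (x : G → ℝ) (j : G) (b : Bool) : ℝ := if b then x j else 1 - x j

lemma sum_bernoulliWeight (x : G → ℝ) (j : G) : ∑ b, bernoulliWeight x j b = 1 := by
  simp [bernoulliWeight]

lemma prodExp_bernoulliWeight (f : Finset G → ℝ) (x : G → ℝ) :
    prodExp (bernoulliWeight x) (fun Z => f (univ.filter fun j => Z j = true)) =
      multilinearExt f x := by
  rw [prodExp_filter (sum_bernoulliWeight x) (fun _ b => b = true)]
  exact multilinearExt_congr_arg fun j => by simp [sum_filter, bernoulliWeight]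

lemma multilinearExt_const (a : ℝ) (x : G → ℝ) : multilinearExt (fun _ => a) x = a := by
  rw [← prodExp_bernoulliWeight, prodExp_const (sum_bernoulliWeight x)]

lemma multilinearExt_insert (f : Finset G → ℝ) (x : G → ℝ) (j : G) :
    multilinearExt (fun S => f (insert j S)) x = multilinearExt f (Function.update x j 1) := by
  rw [← prodExp_bernoulliWeight]
  have := prodExp_filter (sum_bernoulliWeight x) (fun k b => k = j ∨ b = true) f
  rw [show (fun Z : G → Bool => f (insert j (univ.filter fun k => Z k = true))) =
    fun Z => f (univ.filter fun k => k = j ∨ Z k = true) from funext fun Z => by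
      congr 1; ext k; simp, this]
  refine multilinearExt_congr_arg fun k => ?_
  by_cases hk : k = j
  · subst hk; simp [bernoulliWeight]
  · simp [hk, sum_filter, bernoulliWeight]

lemma multilinearExt_inter (f : Finset G → ℝ) (x : G → ℝ) (L : Finset G) :
    multilinearExt (fun S => f (S ∩ L)) x = multilinearExt f (restrictTo L x) := by
  rw [← prodExp_bernoulliWeight]
  have := prodExp_filter (sum_bernoulliWeight x) (fun k b => b = true ∧ k ∈ L) f
  rw [show (fun Z : G → Bool => f ((univ.filter fun k => Z k = true) ∩ L)) =
    fun Z => f (univ.filter fun k => Z k = true ∧ k ∈ L) from funext fun Z => by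
      congr 1; ext k; simp, this]
  refine multilinearExt_congr_arg fun k => ?_
  by_cases hk : k ∈ L <;> simp [hk, sum_filter, bernoulliWeight, restrictTo]

lemma multilinearExt_erase (f : Finset G → ℝ) (x : G → ℝ) (j : G) :
    multilinearExt (fun S => f (S.erase j)) x = multilinearExt f (Function.update x j 0) := by
  have := multilinearExt_inter f x (univ.erase j)
  simp only [Finset.inter_erase, Finset.inter_univ] at this
  rw [this]
  refine multilinearExt_congr_arg fun k => ?_
  by_cases hk : k = j
  · subst hk; simp [restrictTo]
  · simp [hk, restrictTo]

/-- The multilinear extension is affine in each coordinate. -/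
lemma multilinearExt_update (f : Finset G → ℝ) (x : G → ℝ) (j : G) (t : ℝ) :
    multilinearExt f (Function.update x j t) =
      (1 - t) * multilinearExt f (Function.update x j 0) +
        t * multilinearExt f (Function.update x j 1) := by
  unfold multilinearExt
  rw [mul_sum, mul_sum, ← sum_add_distrib]
  refine sum_congr rfl fun S _ => ?_
  have h : ∀ (t : ℝ) (k : G), 1 - Function.update x j t k =
      Function.update (fun k => 1 - x k) j (1 - t) k := fun t k => by
    by_cases hk : k = j
    · subst hk; simp
    · simp [hk]
  simp only [h]
  by_cases hj : j ∈ S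
  · have hj' : j ∉ Sᶜ := by simpa using hj
    simp only [prod_update_of_mem hj, prod_update_of_notMem hj']
    ring
  · have hj' : j ∈ Sᶜ := by simpa using hj
    simp only [prod_update_of_mem hj', prod_update_of_notMem hj]
    ring

lemma multilinearExt_split (f : Finset G → ℝ) (x : G → ℝ) (j : G) :
    multilinearExt f x = (1 - x j) * multilinearExt f (Function.update x j 0) +
        x j * multilinearExt f (Function.update x j 1) := by
  rw [← multilinearExt_update, Function.update_eq_self]

lemma multilinearExt_mem (x : G → ℝ) (j : G) :
    multilinearExt (fun S => if j ∈ S then 1 else 0) x = x j := by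
  rw [multilinearExt_split _ x j, ← multilinearExt_erase, ← multilinearExt_insert]
  simp [multilinearExt_const]

lemma multilinearExt_indicator (f : Finset G → ℝ) (S : Finset G) :
    multilinearExt f (fun j => if j ∈ S then 1 else 0) = f S := by
  have := multilinearExt_inter f (fun _ => 1) S
  have h1 : ∀ (g : Finset G → ℝ), multilinearExt g (fun _ => 1) = g univ := fun g => by
    unfold multilinearExt
    rw [sum_eq_single univ]
    · simp
    · intro T _ hT
      obtain ⟨j, hj⟩ : ∃ j, j ∈ Tᶜ := by
        by_contra! h
        exact hT (by simpa [Finset.ext_iff] using h)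
      rw [prod_eq_zero hj (by simp), mul_zero]
    · simp
  rw [h1] at this
  rw [univ_inter] at this
  exact this.symm

/-- Independent random sets: their union includes `j` with probability `x j + y j - x j * y j`. -/
lemma multilinearExt_union (f : Finset G → ℝ) (x y : G → ℝ) :
    multilinearExt (fun S => multilinearExt (fun R => f (R ∪ S)) x) y =
      multilinearExt f (fun j => x j + y j - x j * y j) := by
  have h := prodExp_filter (q := fun j (b : Bool × Bool) =>
    bernoulliWeight x j b.1 * bernoulliWeight y j b.2)
    (fun j => by simp [Fintype.sum_prod_type, bernoulliWeight]; ring)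
    (fun _ b => b.1 = true ∨ b.2 = true) f
  have h2 : (multilinearExt f fun j => x j + y j - x j * y j) = multilinearExt f (fun j =>
      ∑ b : Bool × Bool with (b.1 = true ∨ b.2 = true),
        bernoulliWeight x j b.1 * bernoulliWeight y j b.2) :=
    multilinearExt_congr_arg fun j => by
      simp [sum_filter, Fintype.sum_prod_type, bernoulliWeight]; ring
  rw [h2, ← h]
  simp only [← prodExp_bernoulliWeight]
  unfold prodExp
  simp only [mul_sum]
  rw [← (Equiv.arrowProdEquivProdArrow G (fun _ => Bool) (fun _ => Bool)).symm.sum_comp,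
    Fintype.sum_prod_type, sum_comm]
  refine sum_congr rfl fun Z _ => sum_congr rfl fun Z' _ => ?_
  simp only [prod_mul_distrib, Equiv.arrowProdEquivProdArrow, Equiv.coe_fn_symm_mk]
  rw [← mul_assoc, mul_comm (∏ j, bernoulliWeight y j (Z' j))]
  congr 2
  ext k
  exact Iff.trans (by simp) mem_filter.symm

/-! ### Monotone submodular functions and their multilinear extensions -/

namespace IsMonotoneSubmodular

variable {f : Finset G → ℝ}

lemma union_le (hf : IsMonotoneSubmodular f) (S T : Finset G) : f (S ∪ T) ≤ f S + f T := by
  linarith [hf.submodular S T, hf.nonneg (S ∩ T)]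

lemma marginal_anti (hf : IsMonotoneSubmodular f) {S T : Finset G} (h : S ⊆ T) (j : G) :
    f (insert j T) - f T ≤ f (insert j S) - f S := by
  by_cases hj : j ∈ T
  · rw [insert_eq_of_mem hj]
    linarith [hf.mono S (insert j S) (subset_insert _ _)]
  · have h1 := hf.submodular (insert j S) T
    rw [insert_inter_of_notMem hj, inter_eq_left.2 h, insert_union, union_eq_right.2 h] at h1
    linarith

lemma union_le_add_sum (hf : IsMonotoneSubmodular f) (R S : Finset G) :
    f (R ∪ S) ≤ f S + ∑ j ∈ R, (f (insert j S) - f S) := by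
  induction R using Finset.induction with
  | empty => simp
  | insert j R hj ih =>
    rw [sum_insert hj, insert_union]
    linarith [hf.marginal_anti (subset_union_right : S ⊆ R ∪ S) j]

lemma le_sum_singleton (hf : IsMonotoneSubmodular f) {R : Finset G} (hR : R.Nonempty) :
    f R ≤ ∑ j ∈ R, f {j} := by
  induction hR using Finset.Nonempty.cons_induction with
  | singleton a => simp
  | cons a s ha _ ih =>
    rw [sum_cons, cons_eq_insert, insert_eq]
    linarith [hf.union_le {a} s]

lemma comp_insert (hf : IsMonotoneSubmodular f) (j : G) :
    IsMonotoneSubmodular fun S => f (insert j S) where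
  nonneg S := hf.nonneg _
  mono S T h := hf.mono _ _ (insert_subset_insert j h)
  submodular S T := by
    have := hf.submodular (insert j S) (insert j T)
    rwa [← insert_inter_distrib, ← insert_union_distrib] at this

variable {x y : G → ℝ}

lemma ext_nonneg (hf : IsMonotoneSubmodular f) (h0 : ∀ j, 0 ≤ x j) (h1 : ∀ j, x j ≤ 1) :
    0 ≤ multilinearExt f x := by
  rw [← multilinearExt_const 0 x]
  exact multilinearExt_mono_fun h0 h1 hf.nonneg

lemma ext_mono (hf : IsMonotoneSubmodular f) (h0 : ∀ j, 0 ≤ x j) (hxy : ∀ j, x j ≤ y j)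
    (h1 : ∀ j, y j ≤ 1) : multilinearExt f x ≤ multilinearExt f y := by
  -- Couple the two random sets: each item is in both, only in the larger one, or in neither.
  set q : G → Fin 3 → ℝ := fun j => ![x j, y j - x j, 1 - y j] with hq
  have hs : ∀ j, ∑ b, q j b = 1 := fun j => by simp [hq, Fin.sum_univ_three]
  have h2 := prodExp_filter hs (fun _ b => b = 0) f
  have h3 := prodExp_filter hs (fun _ b => b = 0 ∨ b = 1) f
  rw [multilinearExt_congr_arg (x := x) fun j => show x j = ∑ b with b = 0, q j b by
      simp [hq, sum_filter],
    multilinearExt_congr_arg (x := y) fun j => show y j = ∑ b with b = 0 ∨ b = 1, q j b by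
      simp [hq, sum_filter, Fin.sum_univ_three], ← h2, ← h3]
  refine prodExp_mono (fun j b => ?_) fun Z => hf.mono _ _ fun j => ?_
  · fin_cases b <;> simp [hq, h0, hxy, h1]
  · simp only [mem_filter, mem_univ, true_and]; exact Or.inl

lemma ext_add_le (hf : IsMonotoneSubmodular f) (hx : ∀ j, 0 ≤ x j) (hy : ∀ j, 0 ≤ y j)
    (h1 : ∀ j, x j + y j ≤ 1) :
    multilinearExt f (fun j => x j + y j) ≤ multilinearExt f x + multilinearExt f y := by
  -- Couple the two random sets so that they are disjoint.
  set q : G → Fin 3 → ℝ := fun j => ![x j, y j, 1 - (x j + y j)] with hq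
  have hs : ∀ j, ∑ b, q j b = 1 := fun j => by simp [hq, Fin.sum_univ_three]
  have h2 := prodExp_filter hs (fun _ b => b = 0) f
  have h3 := prodExp_filter hs (fun _ b => b = 1) f
  have h4 := prodExp_filter hs (fun _ b => b = 0 ∨ b = 1) f
  rw [multilinearExt_congr_arg (x := x) fun j => show x j = ∑ b with b = 0, q j b by
      simp [hq, sum_filter],
    multilinearExt_congr_arg (x := y) fun j => show y j = ∑ b with b = 1, q j b by
      simp [hq, sum_filter],
    multilinearExt_congr_arg (x := fun j => x j + y j) fun j =>
      show x j + y j = ∑ b with b = 0 ∨ b = 1, q j b by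
        simp [hq, sum_filter, Fin.sum_univ_three], ← h2, ← h3, ← h4, ← prodExp_add]
  refine prodExp_mono (fun j b => ?_) fun Z => ?_
  · fin_cases b <;> simp [hq, hx, hy, h1]
  · rw [filter_or]
    exact hf.union_le _ _

lemma ext_le_two_mul_ext_half (hf : IsMonotoneSubmodular f) (h0 : ∀ j, 0 ≤ x j)
    (h1 : ∀ j, x j ≤ 1) :
    multilinearExt f x ≤ 2 * multilinearExt f (fun j => 1 / 2 * x j) := by
  have := hf.ext_add_le (x := fun j => 1 / 2 * x j) (y := fun j => 1 / 2 * x j)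
    (fun j => by linarith [h0 j]) (fun j => by linarith [h0 j]) (fun j => by linarith [h1 j])
  rw [multilinearExt_congr_arg (y := x) fun j => by ring] at this
  linarith

/-- The expected value of a random set is at most the value of a fixed set `S`, plus the expected
sum of the marginal values with respect to `S`. -/
lemma ext_le_add_sum (hf : IsMonotoneSubmodular f) (h0 : ∀ j, 0 ≤ x j) (h1 : ∀ j, x j ≤ 1)
    (S : Finset G) : multilinearExt f x ≤ f S + ∑ j, x j * (f (insert j S) - f S) := by
  have h : ∀ R, f R ≤ f S + ∑ j, (f (insert j S) - f S) * (if j ∈ R then 1 else 0) := by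
    intro R
    refine (hf.mono _ _ subset_union_left).trans ((hf.union_le_add_sum R S).trans ?_)
    simp
  refine (multilinearExt_mono_fun h0 h1 h).trans ?_
  rw [multilinearExt_add, multilinearExt_const, multilinearExt_sum]
  simp only [multilinearExt_const_mul, multilinearExt_mem, mul_comm, le_refl]

/-- `V(x) ≤ V(y) + ∑_j x_j (V(y with y_j := 1) - V(y))`, as `ext_le_add_sum` shows for each
outcome of the random set belonging to `y`. -/
lemma ext_le_ext_add_sum (hf : IsMonotoneSubmodular f) (hx0 : ∀ j, 0 ≤ x j) (hx1 : ∀ j, x j ≤ 1)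
    (hy0 : ∀ j, 0 ≤ y j) (hy1 : ∀ j, y j ≤ 1) :
    multilinearExt f x ≤ multilinearExt f y +
      ∑ j, x j * (multilinearExt f (Function.update y j 1) - multilinearExt f y) := by
  have := multilinearExt_mono_fun hy0 hy1 (hf.ext_le_add_sum hx0 hx1)
  rw [multilinearExt_const, multilinearExt_add, multilinearExt_sum] at this
  simpa only [multilinearExt_const_mul, multilinearExt_sub, multilinearExt_insert] using this

lemma ext_le_update_one (hf : IsMonotoneSubmodular f) (hy0 : ∀ j, 0 ≤ y j) (hy1 : ∀ j, y j ≤ 1)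
    (j : G) : multilinearExt f y ≤ multilinearExt f (Function.update y j 1) := by
  rw [← multilinearExt_insert]
  exact multilinearExt_mono_fun hy0 hy1 fun S => hf.mono _ _ (subset_insert _ _)

lemma ext_update_zero_le (hf : IsMonotoneSubmodular f) (hy0 : ∀ j, 0 ≤ y j) (hy1 : ∀ j, y j ≤ 1)
    (j : G) : multilinearExt f (Function.update y j 0) ≤ multilinearExt f y := by
  rw [← multilinearExt_erase]
  exact multilinearExt_mono_fun hy0 hy1 fun S => hf.mono _ _ (erase_subset _ _)

/-- If all marginal values of the items that can occur are at most `b`, then the variance of `f` at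
the random set is at most `b` times the mean of `f - f(∅)`. The proof conditions on whether an item
is included: the two conditional means differ by at most the value of that item. -/
lemma variance_le (hf : IsMonotoneSubmodular f) (h0 : ∀ j, 0 ≤ x j) (h1 : ∀ j, x j ≤ 1) {b : ℝ}
    (hb : ∀ j, x j ≠ 0 → f {j} - f ∅ ≤ b) :
    multilinearExt (fun S => f S ^ 2) x - multilinearExt f x ^ 2 ≤
      b * (multilinearExt f x - f ∅) := by
  suffices h : ∀ (T : Finset G) (x : G → ℝ) (f : Finset G → ℝ), IsMonotoneSubmodular f →
      (∀ j, 0 ≤ x j) → (∀ j, x j ≤ 1) → (∀ j, x j ≠ 0 → f {j} - f ∅ ≤ b) →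
      (∀ j, x j ≠ 0 → j ∈ T) →
      multilinearExt (fun S => f S ^ 2) x - multilinearExt f x ^ 2 ≤
        b * (multilinearExt f x - f ∅) from
    h univ x f hf h0 h1 hb fun _ _ => mem_univ _
  clear! x f
  intro T
  induction T using Finset.induction with
  | empty =>
    intro x f _ _ _ _ hT
    have hx : ∀ g : Finset G → ℝ, multilinearExt g x = g ∅ := fun g => by
      rw [← multilinearExt_indicator g ∅]
      exact multilinearExt_congr_arg fun j => by simpa using not_imp_comm.1 (hT j)
    simp [hx]
  | insert j T _ ih =>
    intro x f hf h0 h1 hb hT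
    set x0 := Function.update x j 0 with hx0
    have hx00 : ∀ k, 0 ≤ x0 k := fun k => by
      by_cases hk : k = j
      · subst hk; simp [hx0]
      · simp [hx0, hk, h0]
    have hx01 : ∀ k, x0 k ≤ 1 := fun k => by
      by_cases hk : k = j
      · subst hk; simp [hx0]
      · simp [hx0, hk, h1]
    have hsupp : ∀ k, x0 k ≠ 0 → x k ≠ 0 ∧ k ∈ T := fun k => by
      by_cases hk : k = j
      · subst hk; simp [hx0]
      · intro h
        have h' : x k ≠ 0 := by simpa [hx0, hk] using h
        exact ⟨h', (mem_insert.1 (hT k h')).resolve_left hk⟩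
    have ih0 := ih x0 f hf hx00 hx01 (fun k hk => hb k (hsupp k hk).1) fun k hk => (hsupp k hk).2
    have ih1 := ih x0 _ (hf.comp_insert j) hx00 hx01 (fun k hk => by
        have := hf.marginal_anti (empty_subset {j}) k
        have h2 := hb k (hsupp k hk).1
        rw [pair_comm]
        simp only [insert_empty] at this ⊢
        linarith) fun k hk => (hsupp k hk).2
    have hu : ∀ g : Finset G → ℝ, multilinearExt g x =
        (1 - x j) * multilinearExt g x0 + x j * multilinearExt (fun S => g (insert j S)) x0 :=
      fun g => by
        rw [multilinearExt_insert, hx0, Function.update_idem]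
        exact multilinearExt_split g x j
    have hd0 : multilinearExt f x0 ≤ multilinearExt (fun S => f (insert j S)) x0 :=
      multilinearExt_mono_fun hx00 hx01 fun S => hf.mono _ _ (subset_insert _ _)
    have hd1 : multilinearExt (fun S => f (insert j S)) x0 ≤
        multilinearExt f x0 + (f {j} - f ∅) := by
      rw [← multilinearExt_const (f {j} - f ∅) x0, ← multilinearExt_add]
      refine multilinearExt_mono_fun hx00 hx01 fun S => ?_
      have := hf.marginal_anti (empty_subset S) j
      simp only [insert_empty] at this
      linarith
    rw [hu (fun S => f S ^ 2), hu f]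
    simp only [insert_empty] at ih1
    have hbj : x j = 0 ∨ f {j} - f ∅ ≤ b := by
      by_cases h : x j = 0
      exacts [Or.inl h, Or.inr (hb j h)]
    generalize multilinearExt f x0 = E0 at *
    generalize multilinearExt (fun S => f (insert j S)) x0 = E1 at *
    generalize multilinearExt (fun S => f S ^ 2) x0 = Q0 at *
    generalize multilinearExt (fun S => f (insert j S) ^ 2) x0 = Q1 at *
    rcases hbj with h | h
    · rw [h]; linarith
    · have e1 := mul_le_mul_of_nonneg_left ih0 (sub_nonneg.2 (h1 j))
      have e2 := mul_le_mul_of_nonneg_left ih1 (h0 j)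
      have e3 : (E1 - E0) ^ 2 ≤ b * (f {j} - f ∅) := by nlinarith
      have e4 : x j * (1 - x j) * (E1 - E0) ^ 2 ≤ x j * (b * (f {j} - f ∅)) := by
        rw [mul_assoc]
        refine mul_le_mul_of_nonneg_left (le_trans ?_ e3) (h0 j)
        nlinarith [h0 j, sq_nonneg (E1 - E0)]
      nlinarith

end IsMonotoneSubmodular

/-! ### Iterated continuous greedy -/

lemma contDiff_multilinearExt (f : Finset G → ℝ) : ContDiff ℝ 1 (multilinearExt f) := by
  unfold multilinearExt
  refine ContDiff.sum fun S _ => (contDiff_const.mul (contDiff_prod fun j _ => ?_)).mul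
    (contDiff_prod fun j _ => ?_)
  · fun_prop
  · fun_prop

lemma fderiv_multilinearExt (f : Finset G → ℝ) (y z : G → ℝ) :
    fderiv ℝ (multilinearExt f) y z = ∑ j, z j *
      (multilinearExt f (Function.update y j 1) - multilinearExt f (Function.update y j 0)) := by
  have hd := (contDiff_multilinearExt f).differentiable one_ne_zero y
  conv_lhs => rw [pi_eq_sum_univ' z, map_sum]
  refine sum_congr rfl fun j _ => ?_
  rw [map_smul, smul_eq_mul]
  congr 1
  have h1 : HasDerivAt (fun t => multilinearExt f (Function.update y j t))
      (fderiv ℝ (multilinearExt f) y (Pi.single j 1)) (y j) := by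
    have hd' : HasFDerivAt (multilinearExt f) (fderiv ℝ (multilinearExt f) y)
        (Function.update y j (y j)) := by
      rw [Function.update_eq_self]
      exact hd.hasFDerivAt
    exact hd'.comp_hasDerivAt (y j) (hasDerivAt_update y j (y j))
  have h2 : HasDerivAt (fun t => multilinearExt f (Function.update y j t))
      (-1 * multilinearExt f (Function.update y j 0) +
        1 * multilinearExt f (Function.update y j 1)) (y j) := by
    rw [show (fun t => multilinearExt f (Function.update y j t)) = fun t =>
      (1 - t) * multilinearExt f (Function.update y j 0) +
        t * multilinearExt f (Function.update y j 1) from funext (multilinearExt_update f y j)]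
    exact (((hasDerivAt_id (y j)).const_sub 1).mul_const _).add
      ((hasDerivAt_id (y j)).mul_const _)
  rw [h1.unique h2]
  ring

/-- Since `V` is affine in each coordinate, `∂_j V(y) = V(y with y_j := 1) - V(y with y_j := 0)`,
which is at least the marginal value `V(y with y_j := 1) - V(y)`. -/
lemma IsMonotoneSubmodular.ext_sub_le_fderiv {f : Finset G → ℝ} (hf : IsMonotoneSubmodular f)
    {x y : G → ℝ} (hx0 : ∀ j, 0 ≤ x j) (hx1 : ∀ j, x j ≤ 1)
    (hy0 : ∀ j, 0 ≤ y j) (hy1 : ∀ j, y j ≤ 1) :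
    multilinearExt f x - multilinearExt f y ≤ fderiv ℝ (multilinearExt f) y x := by
  rw [fderiv_multilinearExt, sub_le_iff_le_add']
  refine (hf.ext_le_ext_add_sum hx0 hx1 hy0 hy1).trans ?_
  gcongr with j
  · exact hx0 j
  · exact hf.ext_update_zero_le hy0 hy1 j

open MeasureTheory Set in
/-- If `Φ` is continuously differentiable along a Lipschitz curve `γ`, and its derivative in the
direction of `γ` is at least `C` almost everywhere, then `Φ` grows along `γ` at rate at least `C`. -/
lemma mul_sub_le_of_le_fderiv {E : Type*} [NormedAddCommGroup E] [NormedSpace ℝ E]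
    {γ ζ : ℝ → E} {Φ : E → ℝ} {a b C : ℝ} {K : NNReal} (hab : a ≤ b)
    (hγ : LipschitzOnWith K γ (Icc a b))
    (hder : ∀ᵐ t, t ∈ Ioo a b → HasDerivAt γ (ζ t) t)
    (hΦ : ∀ t ∈ Icc a b, ContDiffAt ℝ 1 Φ (γ t))
    (hC : ∀ t ∈ Icc a b, C ≤ fderiv ℝ Φ (γ t) (ζ t)) :
    C * (b - a) ≤ Φ (γ b) - Φ (γ a) := by
  have hloc : LocallyLipschitzOn (Icc a b) (Φ ∘ γ) := by
    intro t ht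
    obtain ⟨K', U, hU, hKU⟩ := (hΦ t ht).exists_lipschitzOnWith
    refine ⟨K' * K, γ ⁻¹' U ∩ Icc a b, ?_, ?_⟩
    · exact Filter.inter_mem ((hγ.continuousOn t ht) hU) self_mem_nhdsWithin
    · exact hKU.comp (hγ.mono inter_subset_right) fun s hs => hs.1
  obtain ⟨K', hK'⟩ := hloc.exists_lipschitzOnWith_of_compact isCompact_Icc
  rw [← Set.uIcc_of_le hab] at hK'
  have hac := hK'.absolutelyContinuousOnInterval
  have h := hac.integral_deriv_eq_sub
  simp only [Function.comp_apply] at h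
  rw [← h]
  have hconst : C * (b - a) = ∫ _ in a..b, C := by simp [mul_comm]
  rw [hconst]
  refine intervalIntegral.integral_mono_ae_restrict hab (by simp) hac.intervalIntegrable_deriv ?_
  have hne : ∀ c : ℝ, ∀ᵐ t : ℝ, t ≠ c := fun c => by simp [ae_iff, measure_singleton]
  filter_upwards [ae_restrict_mem measurableSet_Icc, ae_restrict_of_ae hder,
    ae_restrict_of_ae (hne a), ae_restrict_of_ae (hne b)] with t ht hdt hta htb
  have hd := hdt ⟨lt_of_le_of_ne ht.1 (Ne.symm hta), lt_of_le_of_ne ht.2 htb⟩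
  have hd2 := ((hΦ t ht).differentiableAt one_ne_zero).hasFDerivAt.comp_hasDerivAt t hd
  rw [hd2.deriv]
  exact hC t ht

section ContinuousGreedy

variable {v : A → Finset G → ℝ} {A' : Finset A} {G' : Finset G} {y z : A → G → ℝ}

lemma LogFeasible.le_one (hy : LogFeasible A' G' y) (i : A) (j : G) : y i j ≤ 1 := by
  by_cases hi : i ∈ A'
  · exact (single_le_sum (fun i _ => hy.nonneg i j) hi).trans (hy.sum_le_one j)
  · rw [hy.eq_zero_of_agent i j hi]; exact zero_le_one

lemma logFeasible_initialSolution : LogFeasible A' G' (initialSolution A' G') where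
  nonneg i j := by unfold initialSolution; positivity
  sum_le_one j := by
    by_cases hA : Fintype.card A = 0
    · have : IsEmpty A := Fintype.card_eq_zero_iff.1 hA
      simp [Finset.eq_empty_of_isEmpty A']
    have hpos : (0 : ℝ) < Fintype.card A := by positivity
    refine (sum_le_card_nsmul A' _ (1 / (Fintype.card A : ℝ)) fun i _ => ?_).trans ?_
    · unfold initialSolution
      split_ifs
      exacts [le_rfl, by positivity]
    · rw [nsmul_eq_mul, mul_one_div, div_le_one hpos]
      exact_mod_cast card_le_univ A'
  eq_zero_of_agent i j hi := by simp [initialSolution, hi]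
  eq_zero_of_item i j hj := by simp [initialSolution, hj]

open MeasureTheory Set in
/-- The properties of a run of continuous greedy that do not depend on the objective. -/
lemma continuousGreedy_curve {y₀ : A → G → ℝ} (h0 : LogFeasible A' G' y₀) {y z : ℝ → A → G → ℝ}
    (hz : ∀ t ∈ Icc (1 / 2 : ℝ) 1, LogFeasible A' G' (z t))
    (hint : ∀ i j, IntervalIntegrable (fun s => z s i j) volume (1 / 2) 1)
    (hy : ∀ t ∈ Icc (1 / 2 : ℝ) 1, ∀ i j,
      y t i j = 1 / 2 * y₀ i j + ∫ s in (1 / 2 : ℝ)..t, z s i j) :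
    LogFeasible A' G' (y 1) ∧
    (∀ s ∈ Icc (1 / 2 : ℝ) 1, ∀ t ∈ Icc (1 / 2 : ℝ) 1, s ≤ t → ∀ i j,
      y s i j ≤ y t i j ∧ y t i j ≤ y s i j + (t - s)) ∧
    ∀ᵐ t, t ∈ Ioo (1 / 2 : ℝ) 1 → ∀ i, HasDerivAt (fun t => y t i) (z t i) t := by
  have hintst : ∀ s ∈ Icc (1 / 2 : ℝ) 1, ∀ t ∈ Icc (1 / 2 : ℝ) 1, ∀ i j,
      IntervalIntegrable (fun u => z u i j) volume s t := fun s hs t ht i j =>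
    (hint i j).mono_set (Set.uIcc_subset_uIcc
      (Set.uIcc_of_le (by norm_num : (1 / 2 : ℝ) ≤ 1) ▸ hs)
      (Set.uIcc_of_le (by norm_num : (1 / 2 : ℝ) ≤ 1) ▸ ht))
  have hhalf : (1 / 2 : ℝ) ∈ Icc (1 / 2 : ℝ) 1 := by norm_num
  have hone : (1 : ℝ) ∈ Icc (1 / 2 : ℝ) 1 := by norm_num
  have hsub : ∀ s ∈ Icc (1 / 2 : ℝ) 1, ∀ t ∈ Icc (1 / 2 : ℝ) 1, ∀ i j,
      y t i j - y s i j = ∫ u in s..t, z u i j := fun s hs t ht i j => by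
    rw [hy t ht, hy s hs, ← intervalIntegral.integral_add_adjacent_intervals
      (hintst _ hhalf s hs i j) (hintst s hs t ht i j)]
    ring
  have hmono : ∀ s ∈ Icc (1 / 2 : ℝ) 1, ∀ t ∈ Icc (1 / 2 : ℝ) 1, s ≤ t → ∀ i j,
      y s i j ≤ y t i j ∧ y t i j ≤ y s i j + (t - s) := by
    intro s hs t ht hst i j
    have h := hsub s hs t ht i j
    have h1 : 0 ≤ ∫ u in s..t, z u i j := intervalIntegral.integral_nonneg hst fun u hu =>
      (hz u ⟨hs.1.trans hu.1, hu.2.trans ht.2⟩).nonneg i j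
    have h2 : ∫ u in s..t, z u i j ≤ ∫ _ in s..t, (1 : ℝ) :=
      intervalIntegral.integral_mono_on hst (hintst s hs t ht i j) (by simp) fun u hu =>
        (hz u ⟨hs.1.trans hu.1, hu.2.trans ht.2⟩).le_one i j
    simp only [intervalIntegral.integral_const, smul_eq_mul, mul_one] at h2
    constructor <;> linarith
  have hyhalf : ∀ i j, y (1 / 2) i j = 1 / 2 * y₀ i j := fun i j => by
    rw [hy _ hhalf]; simp
  refine ⟨⟨fun i j => ?_, fun j => ?_, fun i j hi => ?_, fun i j hj => ?_⟩, hmono, ?_⟩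
  · have := (hmono _ hhalf 1 hone (by norm_num) i j).1
    rw [hyhalf] at this
    linarith [h0.nonneg i j]
  · have h : ∑ i ∈ A', ∫ s in (1 / 2 : ℝ)..1, z s i j ≤ ∫ _ in (1 / 2 : ℝ)..1, (1 : ℝ) := by
      rw [← intervalIntegral.integral_finsetSum fun i _ => hint i j]
      refine intervalIntegral.integral_mono_on (by norm_num) ?_ (by simp) fun u hu =>
        (hz u hu).sum_le_one j
      have := IntervalIntegrable.sum A' (f := fun i s => z s i j) fun i _ => hint i j
      simpa [Finset.sum_fn] using this
    simp only [intervalIntegral.integral_const, smul_eq_mul, mul_one] at h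
    simp only [hy 1 hone, sum_add_distrib, ← mul_sum]
    linarith [h0.sum_le_one j]
  · rw [hy 1 hone, h0.eq_zero_of_agent i j hi, intervalIntegral.integral_congr (g := fun _ => 0)]
    · simp
    · intro u hu
      rw [Set.uIcc_of_le (by norm_num)] at hu
      exact (hz u hu).eq_zero_of_agent i j hi
  · rw [hy 1 hone, h0.eq_zero_of_item i j hj, intervalIntegral.integral_congr (g := fun _ => 0)]
    · simp
    · intro u hu
      rw [Set.uIcc_of_le (by norm_num)] at hu
      exact (hz u hu).eq_zero_of_item i j hj
  · have h := ae_all_iff.2 fun i => ae_all_iff.2 fun j => (hint i j).ae_hasDerivAt_integral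
    filter_upwards [h] with t ht htI i
    refine hasDerivAt_pi.2 fun j => ?_
    rw [Set.uIcc_of_le (by norm_num)] at ht
    have h1 := (ht i j ⟨htI.1.le, htI.2.le⟩ _ hhalf).const_add (1 / 2 * y₀ i j)
    refine h1.congr_of_eventuallyEq ?_
    filter_upwards [Ioo_mem_nhds htI.1 htI.2] with s hs
    exact hy s ⟨hs.1.le, hs.2.le⟩ i j

/-- `greedyObjective` is the derivative of the potential `∑_i log V_i`. -/
lemma contDiffAt_and_fderiv_sum_log (hpos : ∀ i ∈ A', multilinearExt (v i) (y i) ≠ 0) :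
    ContDiffAt ℝ 1 (fun u : A → G → ℝ => ∑ i ∈ A', Real.log (multilinearExt (v i) (u i))) y ∧
    fderiv ℝ (fun u : A → G → ℝ => ∑ i ∈ A', Real.log (multilinearExt (v i) (u i))) y z =
      greedyObjective v A' y z := by
  have hc : ∀ i, ContDiff ℝ 1 fun u : A → G → ℝ => multilinearExt (v i) (u i) := fun i =>
    (contDiff_multilinearExt (v i)).comp (contDiff_apply ℝ (G → ℝ) i)
  constructor
  · exact ContDiffAt.sum fun i hi => (hc i).contDiffAt.log (hpos i hi)
  · have hd : ∀ i, HasFDerivAt (fun u : A → G → ℝ => multilinearExt (v i) (u i))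
        ((fderiv ℝ (multilinearExt (v i)) (y i)).comp
          (ContinuousLinearMap.proj (R := ℝ) (φ := fun _ : A => G → ℝ) i)) y := fun i =>
      HasFDerivAt.comp (f := fun u : A → G → ℝ => u i) y
        ((contDiff_multilinearExt (v i)).differentiable one_ne_zero (y i)).hasFDerivAt
        (hasFDerivAt_apply i y)
    rw [(HasFDerivAt.fun_sum fun i hi => (hd i).log (hpos i hi)).fderiv]
    simp [greedyObjective, div_eq_inv_mul]

lemma LogFeasible.ext_pos (hy : LogFeasible A' G' y) (hv : ∀ i, IsMonotoneSubmodular (v i))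
    {i : A} (hi : 0 < v i G') (hpos : ∀ j ∈ G', 0 < y i j) : 0 < multilinearExt (v i) (y i) := by
  -- The random set is equal to `G'` with positive probability.
  have h1 : 0 < v i G' * (∏ j ∈ G', y i j) * ∏ j ∈ G'ᶜ, (1 - y i j) := by
    rw [prod_eq_one (s := G'ᶜ) fun j hj => by simp [hy.eq_zero_of_item i j (mem_compl.1 hj)],
      mul_one]
    exact mul_pos hi (prod_pos hpos)
  refine h1.trans_le (single_le_sum (f := fun S => v i S * (∏ j ∈ S, y i j) *
    ∏ j ∈ Sᶜ, (1 - y i j)) (fun S _ => ?_) (mem_univ G'))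
  exact mul_nonneg (mul_nonneg ((hv i).nonneg S) (prod_nonneg fun j _ => hy.nonneg i j))
    (prod_nonneg fun j _ => sub_nonneg.2 (hy.le_one i j))

open MeasureTheory Set in
/-- One run of continuous greedy. The logarithmic potential grows at least at the rate given by the
direction `x`, which is at least `∑_i V_i(x_i) / V_i(y_i(t)) - |A'|`, and `y(t) ≤ y(1)`. -/
lemma ContinuousGreedyRun.gain (hv : ∀ i, IsMonotoneSubmodular (v i))
    (hG : ∀ i ∈ A', 0 < v i G') {y₀ y₁ x : A → G → ℝ} (hrun : ContinuousGreedyRun v A' G' y₀ y₁)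
    (h0 : LogFeasible A' G' y₀) (hpos : ∀ i ∈ A', ∀ j ∈ G', 0 < y₀ i j)
    (hx : LogFeasible A' G' x) :
    LogFeasible A' G' y₁ ∧ (∀ i ∈ A', ∀ j ∈ G', 0 < y₁ i j) ∧
    1 / 2 * (∑ i ∈ A', multilinearExt (v i) (x i) / multilinearExt (v i) (y₁ i) - #A') ≤
      ∑ i ∈ A', Real.log (multilinearExt (v i) (y₁ i)) -
      ∑ i ∈ A', Real.log (multilinearExt (v i) fun j => 1 / 2 * y₀ i j) := by
  obtain ⟨y, z, hz, hint, hy, rfl⟩ := hrun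
  obtain ⟨hfeas, hmono, hder⟩ := continuousGreedy_curve h0 (fun t ht => (hz t ht).1) hint hy
  have hhalf : (1 / 2 : ℝ) ∈ Icc (1 / 2 : ℝ) 1 := by norm_num
  have hone : (1 : ℝ) ∈ Icc (1 / 2 : ℝ) 1 := by norm_num
  have hyhalf : ∀ i, y (1 / 2) i = fun j => 1 / 2 * y₀ i j := fun i => by
    ext j; rw [hy _ hhalf]; simp
  have hlow : ∀ t ∈ Icc (1 / 2 : ℝ) 1, ∀ i j, 1 / 2 * y₀ i j ≤ y t i j := fun t ht i j => by
    rw [← congrFun (hyhalf i) j]; exact (hmono _ hhalf t ht ht.1 i j).1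
  have hle1 : ∀ t ∈ Icc (1 / 2 : ℝ) 1, ∀ i j, y t i j ≤ y 1 i j := fun t ht i j =>
    (hmono t ht 1 hone ht.2 i j).1
  have hnn : ∀ t ∈ Icc (1 / 2 : ℝ) 1, ∀ i j, 0 ≤ y t i j := fun t ht i j =>
    (by linarith [h0.nonneg i j] : (0:ℝ) ≤ 1 / 2 * y₀ i j).trans (hlow t ht i j)
  have hVpos : ∀ t ∈ Icc (1 / 2 : ℝ) 1, ∀ i ∈ A', 0 < multilinearExt (v i) (y t i) := by
    intro t ht i hi
    have hf : LogFeasible A' G' (y t) :=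
      ⟨hnn t ht, fun j => (sum_le_sum fun i _ => hle1 t ht i j).trans (hfeas.sum_le_one j),
        fun i j h => le_antisymm ((hle1 t ht i j).trans_eq (hfeas.eq_zero_of_agent i j h))
          (hnn t ht i j),
        fun i j h => le_antisymm ((hle1 t ht i j).trans_eq (hfeas.eq_zero_of_item i j h))
          (hnn t ht i j)⟩
    exact hf.ext_pos hv (hG i hi) fun j hj =>
      lt_of_lt_of_le (by linarith [hpos i hi j hj]) (hlow t ht i j)
  refine ⟨hfeas, fun i hi j hj => lt_of_lt_of_le (by linarith [hpos i hi j hj])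
    (hlow 1 hone i j), ?_⟩
  have hlip : LipschitzOnWith 1 y (Icc (1 / 2 : ℝ) 1) := by
    have key : ∀ s ∈ Icc (1 / 2 : ℝ) 1, ∀ t ∈ Icc (1 / 2 : ℝ) 1, s ≤ t →
        dist (y s) (y t) ≤ dist s t := fun s hs t ht hst => by
      refine (dist_pi_le_iff dist_nonneg).2 fun i => (dist_pi_le_iff dist_nonneg).2 fun j => ?_
      obtain ⟨h1, h2⟩ := hmono s hs t ht hst i j
      rw [dist_comm, Real.dist_eq, dist_comm, Real.dist_eq, abs_of_nonneg (by linarith),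
        abs_of_nonneg (by linarith)]
      linarith
    refine LipschitzOnWith.of_dist_le_mul fun s hs t ht => ?_
    rw [NNReal.coe_one, one_mul]
    rcases le_total s t with h | h
    · exact key s hs t ht h
    · rw [dist_comm, dist_comm s]
      exact key t ht s hs h
  have := mul_sub_le_of_le_fderiv (a := 1 / 2) (b := 1) (by norm_num) hlip
    (ζ := z) (Φ := fun u => ∑ i ∈ A', Real.log (multilinearExt (v i) (u i)))
    (C := ∑ i ∈ A', multilinearExt (v i) (x i) / multilinearExt (v i) (y 1 i) - #A')
    (by filter_upwards [hder] with t ht htI using hasDerivAt_pi.2 (ht htI))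
    (fun t ht => (contDiffAt_and_fderiv_sum_log (z := z t) fun i hi => (hVpos t ht i hi).ne').1) fun t ht => by
      rw [(contDiffAt_and_fderiv_sum_log (z := z t) fun i hi => (hVpos t ht i hi).ne').2]
      refine le_trans ?_ ((hz t ht).2 x hx)
      rw [card_eq_sum_ones, Nat.cast_sum, ← sum_sub_distrib]
      refine sum_le_sum fun i hi => ?_
      have hp := hVpos t ht i hi
      have h1 : ∀ j, y t i j ≤ 1 := fun j => (hle1 t ht i j).trans (hfeas.le_one i j)
      rw [le_div_iff₀ hp, sub_mul]
      refine le_trans ?_ ((hv i).ext_sub_le_fderiv (hx.nonneg i) (hx.le_one i) (hnn t ht i) h1)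
      have h2 := (hv i).ext_mono (hnn t ht i) (hle1 t ht i) (hfeas.le_one i)
      have h3 := (hv i).ext_nonneg (hx.nonneg i) (hx.le_one i)
      have h4 : multilinearExt (v i) (x i) / multilinearExt (v i) (y 1 i) *
          multilinearExt (v i) (y t i) ≤ multilinearExt (v i) (x i) := by
        rw [div_mul_eq_mul_div, div_le_iff₀ (hVpos 1 hone i hi)]
        exact mul_le_mul_of_nonneg_left h2 h3
      push_cast
      linarith
  simp only [hyhalf] at this
  linarith

/-- The output `y` of iterated continuous greedy is, up to a constant, optimal against each feasible
`x` in the average sense. In its last run, halving loses at most `log 2` per agent, while the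
potential has increased by less than `n / 8`. -/
lemma IteratedContinuousGreedy.sum_ratio_le (hv : ∀ i, IsMonotoneSubmodular (v i))
    (hG : ∀ i ∈ A', 0 < v i G') (hy : IteratedContinuousGreedy v A' G' y) :
    LogFeasible A' G' y ∧ (∀ i ∈ A', ∀ j ∈ G', 0 < y i j) ∧
    ∀ x, LogFeasible A' G' x →
      ∑ i ∈ A', multilinearExt (v i) (x i) / multilinearExt (v i) (y i) ≤ 3 * Fintype.card A := by
  obtain ⟨r, Y, hY0, hrun, -, hhalt, rfl⟩ := hy
  have hk : ∀ k ≤ r + 1, LogFeasible A' G' (Y k) ∧ ∀ i ∈ A', ∀ j ∈ G', 0 < Y k i j := by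
    intro k
    induction k with
    | zero =>
      intro _
      rw [hY0]
      refine ⟨logFeasible_initialSolution, fun i hi j hj => ?_⟩
      have : Nonempty A := ⟨i⟩
      simp only [initialSolution, hi, hj, and_self, if_true]
      positivity
    | succ k ih =>
      intro hk
      obtain ⟨h1, h2⟩ := ih (by omega)
      have := (hrun k (by omega)).gain hv hG h1 h2 h1
      exact ⟨this.1, this.2.1⟩
  obtain ⟨h1, h2⟩ := hk r (by omega)
  obtain ⟨h3, h4⟩ := hk (r + 1) le_rfl
  refine ⟨h3, h4, fun x hx => ?_⟩
  rcases isEmpty_or_nonempty A with hA | hA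
  · simp [Finset.eq_empty_of_isEmpty A']
  have hn : (0 : ℝ) < Fintype.card A := by positivity
  have hgain := ((hrun r le_rfl).gain hv hG h1 h2 hx).2.2
  have hlog : ∑ i ∈ A', Real.log (multilinearExt (v i) (Y r i)) - #A' * Real.log 2 ≤
      ∑ i ∈ A', Real.log (multilinearExt (v i) fun j => 1 / 2 * Y r i j) := by
    rw [← nsmul_eq_mul, ← sum_const, ← sum_sub_distrib]
    refine sum_le_sum fun i hi => ?_
    have hp := h1.ext_pos hv (hG i hi) (h2 i hi)
    have h5 := (hv i).ext_le_two_mul_ext_half (h1.nonneg i) (h1.le_one i)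
    rw [← Real.log_div hp.ne' two_ne_zero]
    exact Real.log_le_log (by positivity) (by linarith)
  unfold logObjective at hhalt
  have h6 : ∑ i ∈ A', Real.log (multilinearExt (v i) (Y (r + 1) i)) <
      ∑ i ∈ A', Real.log (multilinearExt (v i) (Y r i)) + 1 / 8 * Fintype.card A := by
    have := mul_lt_mul_of_pos_left hhalt hn
    rw [mul_add, ← mul_assoc, ← mul_assoc, mul_one_div_cancel hn.ne'] at this
    linarith
  have h7 : (#A' : ℝ) ≤ Fintype.card A := by exact_mod_cast card_le_univ A'
  have h8 := Real.log_two_lt_d9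
  have h9 : (#A' : ℝ) * Real.log 2 ≤ Fintype.card A * 0.7 := by
    refine mul_le_mul h7 (by linarith) (Real.log_nonneg (by norm_num)) hn.le
  linarith

end ContinuousGreedy

/-! ### Large items and the loss in the rounding step -/

section LargeItems

variable {w : Finset G → ℝ} {G' L : Finset G} {y : G → ℝ} {c g : ℝ}

lemma restrictTo_nonneg (h0 : ∀ j, 0 ≤ y j) (L : Finset G) (j : G) : 0 ≤ restrictTo L y j := by
  unfold restrictTo; split_ifs
  exacts [h0 j, le_rfl]

lemma restrictTo_le_one (h1 : ∀ j, y j ≤ 1) (L : Finset G) (j : G) : restrictTo L y j ≤ 1 := by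
  unfold restrictTo; split_ifs
  exacts [h1 j, zero_le_one]

lemma marginal_eq_update {j : G} (hj : j ∉ L) : marginal w y L j =
    multilinearExt w (Function.update (restrictTo L y) j 1) -
      multilinearExt w (restrictTo L y) := by
  unfold marginal
  congr 1
  refine multilinearExt_congr_arg fun k => ?_
  by_cases hk : k = j
  · subst hk; simp [restrictTo, hj]
  · simp [hk]

lemma marginal_eq_ext {j : G} (hj : j ∉ L) : marginal w y L j =
    multilinearExt (fun S => w (insert j (S ∩ L)) - w (S ∩ L)) y := by
  rw [marginal_eq_update hj, multilinearExt_sub, ← multilinearExt_insert,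
    ← multilinearExt_inter, ← multilinearExt_inter]

lemma marginal_nonneg (hw : IsMonotoneSubmodular w) (h0 : ∀ j, 0 ≤ y j) (h1 : ∀ j, y j ≤ 1)
    {j : G} (hj : j ∉ L) : 0 ≤ marginal w y L j := by
  rw [marginal_eq_update hj, sub_nonneg]
  exact hw.ext_le_update_one (restrictTo_nonneg h0 L) (restrictTo_le_one h1 L) j

lemma marginal_insert_le (hw : IsMonotoneSubmodular w) (h0 : ∀ j, 0 ≤ y j) (h1 : ∀ j, y j ≤ 1)
    {j k : G} (hk : k ∉ insert j L) : marginal w y (insert j L) k ≤ marginal w y L k := by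
  rw [marginal_eq_ext hk, marginal_eq_ext fun h => hk (mem_insert_of_mem h)]
  exact multilinearExt_mono_fun h0 h1 fun S =>
    hw.marginal_anti (inter_subset_inter_left (subset_insert j L)) k

lemma multilinearExt_restrictTo_insert {j : G} (hj : j ∉ L) :
    multilinearExt w (restrictTo (insert j L) y) =
      multilinearExt w (restrictTo L y) + y j * marginal w y L j := by
  have h : restrictTo (insert j L) y = Function.update (restrictTo L y) j (y j) := by
    ext k
    by_cases hk : k = j
    · subst hk; simp [restrictTo]
    · simp [restrictTo, hk]
  have h' : Function.update (restrictTo L y) j 0 = restrictTo L y := by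
    rw [Function.update_eq_self_iff]; simp [restrictTo, hj]
  rw [h, multilinearExt_update, marginal_eq_update hj, h']
  ring

/-- Each item added to `L` had, at that time, at least the marginal value of an item left outside;
so the latter is at most the value of `L` divided by its fractional mass. -/
lemma LargeSetStage.invariant (hw : IsMonotoneSubmodular w) (h0 : ∀ j, 0 ≤ y j)
    (h1 : ∀ j, y j ≤ 1) (hc : 0 < c) (hL : LargeSetStage w G' y c L) :
    L ⊆ G' ∧ ∑ k ∈ L, y k ≤ c + 1 ∧
      ∀ k ∈ G' \ L, (∑ k ∈ L, y k) * marginal w y L k ≤ multilinearExt w (restrictTo L y) := by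
  induction hL with
  | start =>
    refine ⟨empty_subset _, by simp; linarith, fun k _ => ?_⟩
    simpa using hw.ext_nonneg (restrictTo_nonneg h0 ∅) (restrictTo_le_one h1 ∅)
  | step L j _ hlt hj hmax ih =>
    obtain ⟨ih1, ih2, ih3⟩ := ih
    obtain ⟨hjG, hjL⟩ := mem_sdiff.1 hj
    refine ⟨insert_subset hjG ih1, ?_, fun k hk => ?_⟩
    · rw [sum_insert hjL]; linarith [h1 j]
    · obtain ⟨hkG, hkL⟩ := mem_sdiff.1 hk
      have hkL' : k ∉ L := fun h => hkL (mem_insert_of_mem h)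
      have hk' : k ∈ G' \ L := mem_sdiff.2 ⟨hkG, hkL'⟩
      have hm := marginal_insert_le hw h0 h1 hkL
      rw [sum_insert hjL, multilinearExt_restrictTo_insert hjL, add_mul]
      have e1 := mul_le_mul_of_nonneg_left (hm.trans (hmax k hk')) (h0 j)
      have e2 := mul_le_mul_of_nonneg_left hm (sum_nonneg fun k (_ : k ∈ L) => h0 k)
      linarith [ih3 k hk']

lemma ext_restrictTo_le (hw : IsMonotoneSubmodular w) (h0 : ∀ j, 0 ≤ y j) (h1 : ∀ j, y j ≤ 1)
    (hc : 0 ≤ c) (hL : L ⊆ G') (hmass : ∑ k ∈ L, y k ≤ c + 1) (hg0 : w ∅ ≤ g)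
    (hg : ∀ j ∈ G', w {j} ≤ g) : multilinearExt w (restrictTo L y) ≤ (c + 1) * g := by
  have h := hw.ext_le_add_sum (restrictTo_nonneg h0 L) (restrictTo_le_one h1 L) ∅
  have h2 : ∑ j, restrictTo L y j * (w (insert j ∅) - w ∅) ≤ (∑ j ∈ L, y j) * (g - w ∅) := by
    simp only [restrictTo, ite_mul, zero_mul, sum_ite_mem, univ_inter, sum_mul]
    refine sum_le_sum fun j hj => mul_le_mul_of_nonneg_left ?_ (h0 j)
    simpa using hg j (hL hj)
  have h3 := mul_le_mul_of_nonneg_right hmass (sub_nonneg.2 hg0)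
  nlinarith [hw.nonneg ∅]

/-- The expected gain `E[w(R ∪ S) - w(R)]` from adding `S` to a random set `R` of large items. -/
def residual (w : Finset G → ℝ) (y : G → ℝ) (L S : Finset G) : ℝ :=
  multilinearExt (fun R => w (R ∪ S)) (restrictTo L y) - multilinearExt w (restrictTo L y)

lemma isMonotoneSubmodular_residual (hw : IsMonotoneSubmodular w) (h0 : ∀ j, 0 ≤ y j)
    (h1 : ∀ j, y j ≤ 1) : IsMonotoneSubmodular (residual w y L) where
  nonneg S := sub_nonneg.2 <| multilinearExt_mono_fun (restrictTo_nonneg h0 L)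
    (restrictTo_le_one h1 L) fun R => hw.mono _ _ subset_union_left
  mono S T h := sub_le_sub_right (multilinearExt_mono_fun (restrictTo_nonneg h0 L)
    (restrictTo_le_one h1 L) fun R => hw.mono _ _ (union_subset_union_right h)) _
  submodular S T := by
    have := multilinearExt_mono_fun (restrictTo_nonneg h0 L) (restrictTo_le_one h1 L)
      fun R => hw.submodular (R ∪ S) (R ∪ T)
    simp only [← union_inter_distrib_left, ← union_union_distrib_left, multilinearExt_add] at this
    unfold residual
    linarith

lemma residual_empty : residual w y L ∅ = 0 := by simp [residual]

lemma residual_singleton {j : G} (hj : j ∉ L) : residual w y L {j} = marginal w y L j := by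
  rw [marginal_eq_update hj, ← multilinearExt_insert, residual]
  simp only [union_singleton]

lemma residual_le (hw : IsMonotoneSubmodular w) (h0 : ∀ j, 0 ≤ y j) (h1 : ∀ j, y j ≤ 1)
    (S : Finset G) : residual w y L S ≤ w S := by
  rw [residual, ← multilinearExt_sub, ← multilinearExt_const (w S) (restrictTo L y)]
  refine multilinearExt_mono_fun (restrictTo_nonneg h0 L) (restrictTo_le_one h1 L) fun R => ?_
  linarith [hw.union_le R S]

lemma ext_residual (hy : ∀ j, j ∉ G' → y j = 0) :
    multilinearExt (residual w y L) (restrictTo (G' \ L) y) =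
      multilinearExt w y - multilinearExt w (restrictTo L y) := by
  have : residual w y L = fun S => multilinearExt (fun R => w (R ∪ S)) (restrictTo L y) -
      multilinearExt w (restrictTo L y) := rfl
  rw [this, multilinearExt_sub, multilinearExt_const, multilinearExt_union]
  congr 1
  refine multilinearExt_congr_arg fun j => ?_
  by_cases hj : j ∈ L
  · simp [restrictTo, hj]
  · by_cases hj' : j ∈ G' <;> simp [restrictTo, hj, hj', hy]

/-- The expected ratio between the fractional value `V(y)` and the value of the rounded set of small
items, where the latter is replaced by `g` if it is smaller than `g`. If the large items make up at
least half of `V(y)`, then `V(y) ≤ 2 (c + 1) g`. Otherwise Chebyshev's inequality applies to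
`residual w y L`, whose marginal values are at most `V(y^{(L)}) / c`. -/
lemma ext_ratio_le (hw : IsMonotoneSubmodular w) (h0 : ∀ j, 0 ≤ y j) (h1 : ∀ j, y j ≤ 1)
    (hy : ∀ j, j ∉ G' → y j = 0) (hc : 0 < c) (hL : IsLargeSet w G' y c L) (hg : 0 < g)
    (hg0 : w ∅ ≤ g) (hg1 : ∀ j ∈ G', w {j} ≤ g) :
    multilinearExt (fun S => multilinearExt w y / max (w S) g) (restrictTo (G' \ L) y) ≤
      14 + 8 / c + 2 * c := by
  obtain ⟨hst, hhalt⟩ := hL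
  obtain ⟨hLG, hmass, hinv⟩ := hst.invariant hw h0 h1 hc
  have hl := ext_restrictTo_le hw h0 h1 hc.le hLG hmass hg0 hg1
  have hl0 := hw.ext_nonneg (restrictTo_nonneg h0 L) (restrictTo_le_one h1 L)
  have hM := ext_residual (w := w) (L := L) hy
  have hR := isMonotoneSubmodular_residual (L := L) hw h0 h1
  have hM0 := hR.ext_nonneg (restrictTo_nonneg h0 (G' \ L)) (restrictTo_le_one h1 (G' \ L))
  have hvar := hR.variance_le (restrictTo_nonneg h0 (G' \ L)) (restrictTo_le_one h1 (G' \ L))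
    (b := multilinearExt w (restrictTo L y) / c) fun j hj => by
      have hjL : j ∈ G' \ L := by
        by_contra h
        exact hj (by simp only [restrictTo, h, if_false])
      have hjL' := (mem_sdiff.1 hjL).2
      have hcm : c ≤ ∑ k ∈ L, y k := not_lt.1 fun h => hhalt ⟨h, j, hjL⟩
      rw [residual_empty, residual_singleton hjL', sub_zero, le_div_iff₀ hc, mul_comm]
      exact (mul_le_mul_of_nonneg_right hcm (marginal_nonneg hw h0 h1 hjL')).trans (hinv j hjL)
  have h8c : 0 < 8 / c := by positivity
  have hmono : ∀ {f f' : Finset G → ℝ}, (∀ S, f S ≤ f' S) →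
      multilinearExt f (restrictTo (G' \ L) y) ≤ multilinearExt f' (restrictTo (G' \ L) y) :=
    fun h => multilinearExt_mono_fun (restrictTo_nonneg h0 _) (restrictTo_le_one h1 _) h
  have hle := residual_le (L := L) hw h0 h1
  rw [residual_empty, sub_zero] at hvar
  set V := multilinearExt w y
  set l := multilinearExt w (restrictTo L y)
  set M := multilinearExt (residual w y L) (restrictTo (G' \ L) y)
  rcases lt_or_ge M l with hMl | hMl
  · refine (hmono (f' := fun _ => 2 * (c + 1)) fun S => ?_).trans ?_
    · rw [div_le_iff₀ (lt_max_of_lt_right hg)]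
      have := mul_le_mul_of_nonneg_left (le_max_right (w S) g) (by positivity : 0 ≤ 2 * (c + 1))
      linarith
    · rw [multilinearExt_const]; linarith
  rcases hM0.eq_or_lt with h | hMpos
  · have hV : V = 0 := by linarith
    simp only [hV, zero_div, multilinearExt_const]
    positivity
  have hV : V ≤ 2 * M := by linarith
  have hV0 : 0 < V := by linarith
  -- The first term covers the case `M / 2 ≤ residual w y L S`. Otherwise the deviation from the mean
  -- `M` is at least `M / 2`, and the second term is at least `V / g`.
  refine (hmono (f' := fun S => 2 * V / M + 4 * V / (g * M ^ 2) *
    (residual w y L S ^ 2 + (-2 * M) * residual w y L S + M ^ 2)) fun S => ?_).trans ?_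
  · have hsq : residual w y L S ^ 2 + (-2 * M) * residual w y L S + M ^ 2 =
      (M - residual w y L S) ^ 2 := by ring
    rw [hsq]
    rcases le_or_gt (M / 2) (residual w y L S) with h | h
    · have h2 : V / max (w S) g ≤ 2 * V / M := by
        rw [div_le_div_iff₀ (lt_max_of_lt_right hg) hMpos]
        have := (h.trans (hle S)).trans (le_max_left _ g)
        nlinarith
      have : 0 ≤ 4 * V / (g * M ^ 2) * (M - residual w y L S) ^ 2 := by positivity
      linarith
    · have h2 : V / max (w S) g ≤ V / g := by gcongr; exact le_max_right _ _
      have h3 : V / g ≤ 4 * V / (g * M ^ 2) * (M - residual w y L S) ^ 2 := by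
        have : (M / 2) ^ 2 ≤ (M - residual w y L S) ^ 2 :=
          pow_le_pow_left₀ (by positivity) (by linarith) 2
        calc V / g = 4 * V / (g * M ^ 2) * (M / 2) ^ 2 := by field_simp; norm_num
          _ ≤ _ := by gcongr
      have : 0 ≤ 2 * V / M := by positivity
      linarith
  · rw [multilinearExt_add, multilinearExt_const, multilinearExt_const_mul, multilinearExt_add,
      multilinearExt_add, multilinearExt_const, multilinearExt_const_mul]
    have e1 : 2 * V / M ≤ 4 := by rw [div_le_iff₀ hMpos]; linarith
    have e2 : 4 * V / (g * M ^ 2) * (multilinearExt (fun S => residual w y L S ^ 2)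
        (restrictTo (G' \ L) y) + (-2 * M) * M + M ^ 2) ≤ 8 * (c + 1) / c := by
      have e3 : 4 * V / (g * M ^ 2) ≤ 8 / (g * M) := by
        rw [div_le_div_iff₀ (by positivity) (by positivity)]
        nlinarith [mul_pos hg hMpos]
      have e4 : l / c * M ≤ (c + 1) * g / c * M := by gcongr
      calc _ ≤ 4 * V / (g * M ^ 2) * ((c + 1) * g / c * M) := by
            gcongr; linarith
        _ ≤ 8 / (g * M) * ((c + 1) * g / c * M) := by gcongr
        _ = 8 * (c + 1) / c := by field_simp
    have e5 : 8 * (c + 1) / c = 8 + 8 / c := by field_simp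
    linarith

end LargeItems

/-! ### Rematching -/

/-- Let `π` be an injective map from `B` to `H = τ(A)`, and let `T` be a set of agents outside `B`,
each of which would like some item `g i` outside `H`. Then there is a matching into `H` that is as
good as giving `π i` to the agents in `B`, `g i` to those in `T`, and `S i` to all others.

The edges `i → τ⁻¹(π i)` for `i ∈ B` form paths and cycles. On a path which ends in `t ∈ T` the agents
use `τ`: giving `g t` to `t` and `π i` to its predecessors on the path does not improve on the optimal
matching `τ`. All other agents of `B` use `π`, and the rest is matched arbitrarily. -/
theorem exists_matching_prod_le {v : A → Finset G → ℝ} (hv : ∀ i, IsMonotoneSubmodular (v i))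
    {τ : A → G} (hτ : IsOptimalMatching v τ) (hpos : ∀ i, 0 < v i {τ i}) (S : A → Finset G)
    {B T : Finset A} (hBT : Disjoint B T) {π g : A → G} (hπ : Set.InjOn π B)
    (hπH : ∀ i ∈ B, π i ∈ matchedItems τ) (hg : ∀ i ∈ T, g i ∈ remainingItems τ) :
    ∃ ρ : A → G, Function.Injective ρ ∧ (∀ i, ρ i ∈ matchedItems τ) ∧
      ∏ i, (if i ∈ B then v i {π i} else if i ∈ T then v i {g i} else v i (S i)) ≤
        ∏ i, v i (insert (ρ i) (S i)) := by
  classical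
  have hE : ∀ i, ∃ k, (i ∈ B → τ k = π i) ∧ (i ∉ B → k = i) := fun i => by
    by_cases hi : i ∈ B
    · obtain ⟨k, -, hk⟩ := mem_image.1 (hπH i hi)
      exact ⟨k, fun _ => hk, fun h => absurd hi h⟩
    · exact ⟨i, fun h => absurd h hi, fun _ => rfl⟩
  choose E hEB hEn using hE
  have hiter : ∀ i, i ∉ B → ∀ k, E^[k] i = i := fun i hi k =>
    Function.iterate_fixed (hEn i hi) k
  -- The agents on the path that ends in `t`.
  set P : A → Finset A := fun t => univ.filter fun i => ∃ k, E^[k] i = t with hP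
  have memP : ∀ i t, i ∈ P t ↔ ∃ k, E^[k] i = t := fun i t => by simp [hP]
  have hPB : ∀ t ∈ T, ∀ i ∈ P t, i ∈ B → E i ∈ P t := by
    intro t ht i hi hiB
    obtain ⟨k, hk⟩ := (memP i t).1 hi
    cases k with
    | zero =>
      rw [Function.iterate_zero, id] at hk
      exact absurd ht (hk ▸ Finset.disjoint_left.1 hBT hiB)
    | succ k => exact (memP _ t).2 ⟨k, hk⟩
  have hPn : ∀ t, ∀ i ∈ P t, i ∉ B → i = t := fun t i hi hiB => by
    obtain ⟨k, hk⟩ := (memP i t).1 hi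
    rw [← hk, hiter i hiB]
  have hback : ∀ t i, E i ∈ P t → i ∈ P t := fun t i h => by
    obtain ⟨k, hk⟩ := (memP _ t).1 h
    exact (memP i t).2 ⟨k + 1, hk⟩
  have hself : ∀ t, t ∈ P t := fun t => (memP t t).2 ⟨0, rfl⟩
  have hTB : ∀ t ∈ T, t ∉ B := fun t ht h => Finset.disjoint_left.1 hBT h ht
  have huniq : ∀ s ∈ T, ∀ t ∈ T, ∀ i, i ∈ P s → i ∈ P t → s = t := by
    intro s hs t ht i his hit
    obtain ⟨k, hk⟩ := (memP i s).1 his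
    obtain ⟨l, hl⟩ := (memP i t).1 hit
    rcases le_total k l with h | h
    · rw [← hl, ← Nat.sub_add_cancel h, Function.iterate_add_apply, hk, hiter s (hTB s hs)]
    · rw [← hk, ← Nat.sub_add_cancel h, Function.iterate_add_apply, hl, hiter t (hTB t ht)]
  have hdisj : (T : Set A).PairwiseDisjoint P := fun s hs t ht hst =>
    Finset.disjoint_left.2 fun i his hit => hst (huniq s hs t ht i his hit)
  have hτH : ∀ i, τ i ∈ matchedItems τ := fun i => mem_image_of_mem τ (mem_univ i)
  have hgH : ∀ t ∈ T, g t ∉ matchedItems τ := fun t ht => mem_compl.1 (hg t ht)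
  have hpath : ∀ t ∈ T, ∏ i ∈ P t, (if i ∈ B then v i {π i} else if i ∈ T then v i {g i}
      else v i (S i)) ≤ ∏ i ∈ P t, v i {τ i} := by
    intro t ht
    set τ' : A → G := fun i => if i ∈ P t then (if i ∈ B then π i else g i) else τ i with hτ'
    have hcross : ∀ i k, i ∈ P t → k ∉ P t → τ' i ≠ τ' k := by
      intro i k hi hk h
      simp only [hτ', hi, hk, if_true, if_false] at h
      by_cases hiB : i ∈ B
      · rw [if_pos hiB, ← hEB i hiB] at h
        exact hk (hτ.1 h ▸ hPB t ht i hi hiB)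
      · rw [if_neg hiB, hPn t i hi hiB] at h
        exact hgH t ht (h ▸ hτH k)
    have hinj : Function.Injective τ' := by
      intro i k h
      by_cases hi : i ∈ P t <;> by_cases hk : k ∈ P t
      · simp only [hτ', hi, hk, if_true] at h
        by_cases hiB : i ∈ B <;> by_cases hkB : k ∈ B
        · rw [if_pos hiB, if_pos hkB] at h
          exact hπ hiB hkB h
        · rw [if_pos hiB, if_neg hkB, hPn t k hk hkB] at h
          exact absurd (h ▸ hπH i hiB) (hgH t ht)
        · rw [if_neg hiB, if_pos hkB, hPn t i hi hiB] at h
          exact absurd (h ▸ hπH k hkB) (hgH t ht)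
        · rw [hPn t i hi hiB, hPn t k hk hkB]
      · exact absurd h (hcross i k hi hk)
      · exact absurd h.symm (hcross k i hk hi)
      · simp only [hτ', hi, hk, if_false] at h
        exact hτ.1 h
    have hopt := hτ.2 τ' hinj
    rw [← prod_mul_prod_compl (P t), ← prod_mul_prod_compl (P t) fun i => v i {τ i}] at hopt
    have hc : ∏ i ∈ (P t)ᶜ, v i {τ' i} = ∏ i ∈ (P t)ᶜ, v i {τ i} :=
      prod_congr rfl fun i hi => by simp only [hτ', mem_compl.1 hi, if_false]
    rw [hc] at hopt
    refine le_trans (le_of_eq ?_) (le_of_mul_le_mul_right hopt (prod_pos fun i _ => hpos i))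
    refine prod_congr rfl fun i hi => ?_
    simp only [hτ', hi, if_true]
    by_cases hiB : i ∈ B
    · rw [if_pos hiB, if_pos hiB]
    · rw [if_neg hiB, if_neg hiB, if_pos (by rw [hPn t i hi hiB]; exact ht)]
  have hqnn : ∀ i, 0 ≤ (if i ∈ B then v i {π i} else if i ∈ T then v i {g i} else v i (S i)) :=
    fun i => by split_ifs <;> exact (hv i).nonneg _
  set C := T.biUnion P with hC
  have memC : ∀ i, i ∈ C ↔ ∃ t ∈ T, i ∈ P t := fun i => mem_biUnion
  set f : A → G := fun i => if i ∈ C then τ i else π i with hf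
  have hfinj : Set.InjOn f ((C ∪ (B \ C) : Finset A) : Set A) := by
    have hcross : ∀ i k, i ∈ C → k ∈ B → k ∉ C → τ i ≠ π k := by
      intro i k hi hkB hkC h
      rw [← hEB k hkB] at h
      obtain ⟨t, ht, hit⟩ := (memC i).1 hi
      exact hkC ((memC k).2 ⟨t, ht, hback t k (hτ.1 h ▸ hit)⟩)
    intro i hi k hk h
    simp only [coe_union, coe_sdiff, Set.mem_union, Set.mem_sdiff, mem_coe] at hi hk
    by_cases hiC : i ∈ C <;> by_cases hkC : k ∈ C
    · simp only [hf, hiC, hkC, if_true] at h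
      exact hτ.1 h
    · simp only [hf, hiC, hkC, if_true, if_false] at h
      exact absurd h (hcross i k hiC (hk.resolve_left hkC).1 hkC)
    · simp only [hf, hiC, hkC, if_true, if_false] at h
      exact absurd h.symm (hcross k i hkC (hi.resolve_left hiC).1 hiC)
    · simp only [hf, hiC, hkC, if_false] at h
      exact hπ (hi.resolve_left hiC).1 (hk.resolve_left hkC).1 h
  obtain ⟨e, he⟩ := Finset.exists_equiv_extend_of_card_eq (t := matchedItems τ)
    (by rw [matchedItems, card_image_of_injective _ hτ.1, card_univ]) (f := f)
    (by
      refine image_subset_iff.2 fun i hi => ?_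
      rcases mem_union.1 hi with h | h
      · simp only [hf, h, if_true]; exact hτH i
      · simp only [hf, (mem_sdiff.1 h).2, if_false]; exact hπH i (mem_sdiff.1 h).1) hfinj
  refine ⟨fun i => e i, Subtype.val_injective.comp e.injective, fun i => (e i).2, ?_⟩
  rw [← prod_mul_prod_compl C, ← prod_mul_prod_compl C fun i => v i (insert (e i : G) (S i))]
  refine mul_le_mul ?_ ?_ (prod_nonneg fun i _ => hqnn i)
    (prod_nonneg fun i _ => (hv i).nonneg _)
  · calc _ ≤ ∏ i ∈ C, v i {τ i} := by
          rw [hC, prod_biUnion hdisj, prod_biUnion hdisj]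
          exact prod_le_prod (fun t _ => prod_nonneg fun i _ => hqnn i) hpath
      _ ≤ _ := by
          refine prod_le_prod (fun i _ => (hpos i).le) fun i hi => (hv i).mono _ _ ?_
          rw [he i (mem_union_left _ hi)]
          simp [hf, hi]
  · refine prod_le_prod (fun i _ => hqnn i) fun i hi => ?_
    have hiC := mem_compl.1 hi
    by_cases hiB : i ∈ B
    · rw [if_pos hiB, he i (mem_union_right _ (mem_sdiff.2 ⟨hiB, hiC⟩))]
      refine (hv i).mono _ _ ?_
      simp [hf, hiC]
    · rw [if_neg hiB, if_neg fun hiT => hiC ((memC i).2 ⟨i, hiT, hself i⟩)]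
      exact (hv i).mono _ _ (subset_insert _ _)

/-! ### Geometric means -/

lemma geomMean_nonneg {u : A → ℝ} (hu : ∀ i, 0 ≤ u i) : 0 ≤ geomMean u :=
  Real.rpow_nonneg (prod_nonneg fun i _ => hu i) _

lemma geomMean_mono {u w : A → ℝ} (hu : ∀ i, 0 ≤ u i) (h : ∏ i, u i ≤ ∏ i, w i) :
    geomMean u ≤ geomMean w :=
  Real.rpow_le_rpow (prod_nonneg fun i _ => hu i) h (by positivity)

lemma geomMean_mul {u w : A → ℝ} (hu : ∀ i, 0 ≤ u i) (hw : ∀ i, 0 ≤ w i) :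
    geomMean (fun i => u i * w i) = geomMean u * geomMean w := by
  unfold geomMean
  rw [prod_mul_distrib, Real.mul_rpow (prod_nonneg fun i _ => hu i) (prod_nonneg fun i _ => hw i)]

/-- The inequality of the means. The assumption `1 ≤ a` accounts for the empty product. -/
lemma geomMean_le {u : A → ℝ} (hu : ∀ i, 0 ≤ u i) {a : ℝ} (ha : 1 ≤ a)
    (h : ∑ i, u i ≤ a * Fintype.card A) : geomMean u ≤ a := by
  rcases isEmpty_or_nonempty A with hA | hA
  · simpa [geomMean] using ha
  have hn : (0 : ℝ) < Fintype.card A := by positivity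
  unfold geomMean
  rw [← Real.finsetProd_rpow _ _ fun i _ => hu i]
  refine (Real.geom_mean_le_arith_mean_weighted univ (fun _ => 1 / (Fintype.card A : ℝ)) u
    (fun _ _ => by positivity) (by simp [hn.ne']) fun i _ => hu i).trans ?_
  rw [← mul_sum, one_div_mul_eq_div, div_le_iff₀ hn]
  exact h

/-! ### Comparison with the mixed relaxation -/

variable {v : A → Finset G → ℝ} {τ : A → G} {y : A → G → ℝ}

/-- The larger one of `f ∅` and the values of the items in `G'`. -/
lemma IsMonotoneSubmodular.exists_singleton_bound {f : Finset G → ℝ} (hf : IsMonotoneSubmodular f)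
    (G' : Finset G) : ∃ g, f ∅ ≤ g ∧ (∀ j ∈ G', f {j} ≤ g) ∧ (g = f ∅ ∨ ∃ j ∈ G', g = f {j}) ∧
      (0 < f G' → 0 < g) := by
  rcases G'.eq_empty_or_nonempty with rfl | h
  · exact ⟨f ∅, le_rfl, by simp, Or.inl rfl, id⟩
  · obtain ⟨j, hj, hmax⟩ := exists_max_image G' (fun j => f {j}) h
    refine ⟨f {j}, hf.mono _ _ (empty_subset _), hmax, Or.inr ⟨j, hj, rfl⟩, fun hpos => ?_⟩
    by_contra hle
    refine hpos.not_ge ((hf.le_sum_singleton h).trans (sum_nonpos fun k hk => ?_))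
    exact (hmax k hk).trans (not_lt.1 hle)

/-- For each feasible `x`, if the sets `S i` are good on average in comparison with the fractional
solution `y`, then some matching is good in comparison with `x`. Here `V_i(x_i)` is split into the
contributions of `H` and of the other items: the first one is at most the number of items times the
value of the best one, and the second one is compared with `V_i(y_i)`. -/
lemma exists_matching_geomMean_ge (hv : ∀ i, IsMonotoneSubmodular (v i))
    (hτ : IsOptimalMatching v τ) (hpos : ∀ i, 0 < v i {τ i})
    (hy : ∀ x, LogFeasible (activeAgents v τ) (remainingItems τ) x →
      ∑ i ∈ activeAgents v τ, multilinearExt (v i) (x i) / multilinearExt (v i) (y i) ≤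
        3 * Fintype.card A)
    (hVy : ∀ i ∈ activeAgents v τ, 0 < multilinearExt (v i) (y i))
    {g : A → ℝ} (hg : ∀ i, g i = v i ∅ ∨ ∃ j ∈ remainingItems τ, g i = v i {j})
    (hgpos : ∀ i ∈ activeAgents v τ, 0 < g i) (S : A → Finset G) {D : ℝ} (hD : 0 ≤ D)
    (hX : ∑ i ∈ activeAgents v τ, multilinearExt (v i) (y i) / max (v i (S i)) (g i) ≤
      D * Fintype.card A)
    {x : A → G → ℝ} (hx : MixedFeasible (matchedItems τ) x) :
    ∃ ρ : A → G, Function.Injective ρ ∧ (∀ i, ρ i ∈ matchedItems τ) ∧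
      (geomMean fun i => multilinearExt (v i) (x i)) ≤
        4 * (1 + D) * geomMean fun i => v i (insert (ρ i) (S i)) := by
  classical
  set A' := activeAgents v τ with hA'
  set H := matchedItems τ with hH
  set G' := remainingItems τ with hG'
  have hx1 : ∀ i j, x i j ≤ 1 := fun i j =>
    (single_le_sum (fun i _ => hx.nonneg i j) (mem_univ i)).trans (hx.sum_le_one j)
  set K : A → Finset G := fun i => H.filter fun j => x i j = 1 with hK
  have hπ : ∀ i, ∃ j, (K i).Nonempty → j ∈ K i ∧ ∀ k ∈ K i, v i {k} ≤ v i {j} := fun i => by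
    by_cases h : (K i).Nonempty
    · obtain ⟨j, hj, hmax⟩ := exists_max_image (K i) (fun j => v i {j}) h
      exact ⟨j, fun _ => ⟨hj, hmax⟩⟩
    · exact ⟨τ i, fun h' => absurd h' h⟩
  choose π hπ using hπ
  have hKx : ∀ i, ∀ j ∈ K i, x i j = 1 := fun i j hj => (mem_filter.1 hj).2
  have hsumK : ∑ i, (#(K i) : ℝ) ≤ Fintype.card A := by
    have h1 : ∀ i, (#(K i) : ℝ) ≤ ∑ j ∈ H, x i j := fun i => by
      rw [card_eq_sum_ones, Nat.cast_sum]
      refine le_trans (sum_le_sum fun j hj => ?_)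
        (sum_le_sum_of_subset_of_nonneg (filter_subset _ H) fun j _ _ => hx.nonneg i j)
      rw [hKx i j hj, Nat.cast_one]
    refine (sum_le_sum fun i _ => h1 i).trans ?_
    rw [sum_comm]
    refine (sum_le_sum fun j _ => hx.sum_le_one j).trans ?_
    rw [sum_const, nsmul_eq_mul, mul_one, hH, matchedItems, card_image_of_injective _ hτ.1,
      card_univ]
  set r : A → ℝ := fun i => if i ∈ A' then
    multilinearExt (v i) (restrictTo G' (x i)) / multilinearExt (v i) (y i) else 0 with hr
  have hVG0 : ∀ i, 0 ≤ multilinearExt (v i) (restrictTo G' (x i)) := fun i =>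
    (hv i).ext_nonneg (restrictTo_nonneg (hx.nonneg i) _) (restrictTo_le_one (hx1 i) _)
  have hr0 : ∀ i, 0 ≤ r i := fun i => by
    simp only [hr]; split_ifs with hi
    exacts [div_nonneg (hVG0 i) (hVy i hi).le, le_rfl]
  have hsumr : ∑ i, r i ≤ 3 * Fintype.card A := by
    have hfeas : LogFeasible A' G' fun i => if i ∈ A' then restrictTo G' (x i) else 0 := by
      refine ⟨fun i j => ?_, fun j => ?_, fun i j hi => by simp [hi], fun i j hj => ?_⟩
      · split_ifs
        exacts [restrictTo_nonneg (hx.nonneg i) _ _, le_rfl]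
      · refine (sum_le_sum fun i hi => ?_).trans ((sum_le_sum_of_subset_of_nonneg (subset_univ A')
          fun i _ _ => hx.nonneg i j).trans (hx.sum_le_one j))
        simp only [hi, if_true, restrictTo]
        split_ifs
        exacts [le_rfl, hx.nonneg i j]
      · by_cases hi : i ∈ A' <;> simp [hi, restrictTo, hj]
    refine le_trans (le_of_eq ?_) (hy _ hfeas)
    simp only [hr, sum_ite_mem, univ_inter]
    exact sum_congr rfl fun i hi => by rw [if_pos hi]
  set s : A → ℝ := fun i => max (v i (S i)) (g i) with hs
  have hs0 : ∀ i, 0 ≤ s i := fun i => ((hv i).nonneg _).trans (le_max_left _ _)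
  set X : A → ℝ := fun i => if i ∈ A' then multilinearExt (v i) (y i) / s i else 0 with hXdef
  have hX0 : ∀ i, 0 ≤ X i := fun i => by
    simp only [hXdef]; split_ifs with hi
    exacts [div_nonneg (hVy i hi).le (hs0 i), le_rfl]
  set B : Finset A := univ.filter fun i => (K i).Nonempty ∧ s i ≤ v i {π i} with hB
  set T : Finset A := univ.filter fun i => i ∉ B ∧ v i (S i) < g i with hT
  have hgi : ∀ i, ∃ j, v i (S i) < g i → j ∈ G' ∧ g i = v i {j} := fun i => by
    rcases hg i with h | ⟨j, hj, h⟩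
    · refine ⟨τ i, fun h' => absurd h' (not_lt.2 ?_)⟩
      rw [h]; exact (hv i).mono _ _ (empty_subset _)
    · exact ⟨j, fun _ => ⟨hj, h⟩⟩
  choose ι hι using hgi
  obtain ⟨ρ, hρ, hρH, hle⟩ := exists_matching_prod_le hv hτ hpos S (B := B) (T := T) (π := π) (g := ι)
    (Finset.disjoint_left.2 fun i hi hiT => (mem_filter.1 hiT).2.1 hi)
    (fun i hi k hk h => by
      by_contra hne
      have hi' := hKx i _ (hπ i (mem_filter.1 hi).2.1).1
      have hk' := hKx k _ (hπ k (mem_filter.1 hk).2.1).1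
      rw [← h] at hk'
      have := (sum_le_sum_of_subset_of_nonneg (subset_univ {i, k})
        fun l _ _ => hx.nonneg l (π i)).trans (hx.sum_le_one (π i))
      rw [sum_pair hne, hi', hk'] at this
      norm_num at this)
    (fun i hi => (mem_filter.1 (hπ i (mem_filter.1 hi).2.1).1).1)
    (fun i hi => (hι i (mem_filter.1 hi).2.2).1)
  refine ⟨ρ, hρ, hρH, ?_⟩
  set q : A → ℝ := fun i =>
    if i ∈ B then v i {π i} else if i ∈ T then v i {ι i} else v i (S i) with hq
  have hsq : ∀ i, s i ≤ q i := fun i => by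
    by_cases hi : i ∈ B
    · simp only [hq, hi, if_true]; exact (mem_filter.1 hi).2.2
    · by_cases hiT : i ∈ T
      · have := (mem_filter.1 hiT).2.2
        simp only [hq, hi, hiT, if_true, if_false, hs, ← (hι i this).2]
        exact max_le this.le le_rfl
      · have : g i ≤ v i (S i) := by
          by_contra h
          exact hiT (mem_filter.2 ⟨mem_univ i, hi, not_le.1 h⟩)
        simp only [hq, hi, hiT, if_false, hs]
        exact max_le le_rfl this
  have hq0 : ∀ i, 0 ≤ q i := fun i => (hs0 i).trans (hsq i)
  have hπq : ∀ i, (K i).Nonempty → v i {π i} ≤ q i := fun i hi => by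
    by_cases hiB : i ∈ B
    · simp only [hq, hiB, if_true, le_refl]
    · have : v i {π i} < s i := by
        by_contra h
        exact hiB (mem_filter.2 ⟨mem_univ i, hi, not_lt.1 h⟩)
      exact this.le.trans (hsq i)
  -- The contribution of `H`.
  have hxH : ∀ i, multilinearExt (v i) (x i) ≤
      #(K i) * q i + multilinearExt (v i) (restrictTo G' (x i)) := by
    intro i
    have hmemG : ∀ j, j ∈ G' ↔ j ∉ H := fun j => by rw [hG', remainingItems, mem_compl]
    have hsplit : ∀ j, x i j = (if j ∈ K i then 1 else 0) + restrictTo G' (x i) j := fun j => by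
      by_cases hj : j ∈ H
      · rcases hx.integral i j hj with h | h <;> simp [restrictTo, hmemG, hj, hK, h]
      · simp [restrictTo, hmemG, hj, hK]
    rcases (K i).eq_empty_or_nonempty with h | h
    · rw [multilinearExt_congr_arg (y := restrictTo G' (x i)) fun j => by
        rw [hsplit j, h]; simp]
      simp [h]
    · rw [multilinearExt_congr_arg hsplit]
      refine ((hv i).ext_add_le (fun j => by split_ifs <;> norm_num)
        (restrictTo_nonneg (hx.nonneg i) _) fun j => (hsplit j).symm.trans_le (hx1 i j)).trans ?_
      rw [multilinearExt_indicator]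
      gcongr
      refine ((hv i).le_sum_singleton h).trans ?_
      rw [← nsmul_eq_mul]
      exact sum_le_card_nsmul _ _ _ fun j hj => ((hπ i h).2 j hj).trans (hπq i h)
  have hmain : ∀ i, multilinearExt (v i) (x i) ≤ (#(K i) + r i) * (1 + X i) * q i := by
    intro i
    refine (hxH i).trans ?_
    have hK0 : (0 : ℝ) ≤ #(K i) := by positivity
    have e1 : multilinearExt (v i) (restrictTo G' (x i)) ≤ r i * X i * q i := by
      by_cases hi : i ∈ A'
      · have hspos : 0 < s i := lt_max_of_lt_right (hgpos i hi)
        have : multilinearExt (v i) (restrictTo G' (x i)) = r i * X i * s i := by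
          simp only [hr, hXdef, hi, if_true]
          have := (hVy i hi).ne'
          field_simp
        rw [this]
        exact mul_le_mul_of_nonneg_left (hsq i) (mul_nonneg (hr0 i) (hX0 i))
      · simp only [hr, hi, if_false, zero_mul]
        have h1 : v i G' ≤ 0 := by
          by_contra h
          exact hi (mem_filter.2 ⟨mem_univ i, not_le.1 h⟩)
        refine le_trans ?_ h1
        rw [← multilinearExt_indicator (v i) G']
        refine (hv i).ext_mono (restrictTo_nonneg (hx.nonneg i) _) (fun j => ?_)
          (fun j => by split_ifs <;> norm_num)
        unfold restrictTo
        split_ifs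
        exacts [hx1 i j, le_rfl]
    have e2 : 0 ≤ (#(K i) * X i + r i) * q i :=
      mul_nonneg (add_nonneg (mul_nonneg hK0 (hX0 i)) (hr0 i)) (hq0 i)
    nlinarith
  have hX1 : ∀ i, 0 ≤ 1 + X i := fun i => by linarith [hX0 i]
  have hKr : ∀ i, 0 ≤ #(K i) + r i := fun i => add_nonneg (by positivity) (hr0 i)
  calc (geomMean fun i => multilinearExt (v i) (x i))
      ≤ geomMean fun i => (#(K i) + r i) * (1 + X i) * q i :=
        geomMean_mono (fun i => (hv i).ext_nonneg (hx.nonneg i) (hx1 i))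
          (prod_le_prod (fun i _ => (hv i).ext_nonneg (hx.nonneg i) (hx1 i)) fun i _ => hmain i)
    _ = geomMean (fun i => #(K i) + r i) * geomMean (fun i => 1 + X i) * geomMean q := by
        rw [geomMean_mul (fun i => mul_nonneg (hKr i) (hX1 i)) hq0, geomMean_mul hKr hX1]
    _ ≤ 4 * (1 + D) * geomMean fun i => v i (insert (ρ i) (S i)) := by
        refine mul_le_mul (mul_le_mul (geomMean_le hKr (by norm_num) ?_)
          (geomMean_le hX1 (by linarith) ?_) (geomMean_nonneg hX1) (by norm_num))
          (geomMean_mono hq0 hle) (geomMean_nonneg hq0) (by linarith)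
        · rw [sum_add_distrib]
          linarith
        · rw [sum_add_distrib, sum_const, card_univ, nsmul_eq_mul, mul_one, add_mul, one_mul]
          simpa only [hXdef, sum_ite_mem, univ_inter, add_le_add_iff_left] using hX

/-- If each feasible `x` is matched up to the factor `C` by some `ρ`, then so is the optimum. -/
lemma existsMatchingAbove_of_forall (hv : ∀ i, IsMonotoneSubmodular (v i))
    {S : A → Finset G} {C b : ℝ} (hC : 0 < C) (hCb : C ≤ b)
    (h : ∀ x, MixedFeasible (matchedItems τ) x → ∃ ρ : A → G, Function.Injective ρ ∧
      (∀ i, ρ i ∈ matchedItems τ) ∧ (geomMean fun i => multilinearExt (v i) (x i)) ≤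
        C * geomMean fun i => v i (insert (ρ i) (S i))) :
    ExistsMatchingAbove v (matchedItems τ) S (mixedOPT v (matchedItems τ) / b) := by
  classical
  have h0 : MixedFeasible (matchedItems τ) (0 : A → G → ℝ) :=
    ⟨by simp, by simp, by simp⟩
  obtain ⟨ρ₀, hρ₀, hρ₀H, -⟩ := h 0 h0
  -- The matching in `h` may depend on `x`; a best one works for all `x`.
  obtain ⟨ρ, hρ, hmax⟩ := exists_max_image
    (univ.filter fun ρ : A → G => Function.Injective ρ ∧ ∀ i, ρ i ∈ matchedItems τ)
    (fun ρ => geomMean fun i => v i (insert (ρ i) (S i))) ⟨ρ₀, by simp [hρ₀, hρ₀H]⟩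
  obtain ⟨-, hρ, hρH⟩ := mem_filter.1 hρ
  refine ⟨ρ, hρ, hρH, ?_⟩
  rw [div_le_iff₀ (hC.trans_le hCb), mixedOPT]
  refine csSup_le ⟨_, 0, h0, rfl⟩ ?_
  rintro _ ⟨x, hx, rfl⟩
  obtain ⟨ρ', hρ', hρ'H, hle⟩ := h x hx
  have h1 := hmax ρ' (by simp [hρ', hρ'H])
  have h2 : 0 ≤ geomMean fun i => v i (insert (ρ i) (S i)) :=
    geomMean_nonneg fun i => (hv i).nonneg _
  calc _ ≤ C * geomMean fun i => v i (insert (ρ' i) (S i)) := hle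
    _ ≤ C * geomMean fun i => v i (insert (ρ i) (S i)) := by gcongr
    _ ≤ (geomMean fun i => v i (insert (ρ i) (S i))) * b := by rw [mul_comm]; gcongr

/-! ### The probability of success -/

lemma sum_assignWeight (y : A → G → ℝ) (j : G) : ∑ b, assignWeight y j b = 1 := by
  simp [Fintype.sum_option, assignWeight]

lemma assignWeight_nonneg {A' : Finset A} {G' : Finset G} (hy : LogFeasible A' G' y) (j : G)
    (b : Option A) : 0 ≤ assignWeight y j b := by
  cases b with
  | some i => exact hy.nonneg i j
  | none =>
    refine sub_nonneg.2 (le_trans (le_of_eq ?_) (hy.sum_le_one j))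
    exact (sum_subset (subset_univ A') fun i _ hi => hy.eq_zero_of_agent i j hi).symm

lemma prodExp_smallItems {A' : Finset A} {G' : Finset G} (y : A → G → ℝ) (L : A → Finset G) {i : A}
    (hi : i ∈ A') (f : Finset G → ℝ) :
    prodExp (assignWeight y) (fun Z => f (smallItems A' G' L Z i)) =
      multilinearExt f (restrictTo (G' \ L i) (y i)) := by
  classical
  have h := prodExp_filter (sum_assignWeight y) (fun j b => j ∈ G' \ L i ∧ b = some i) f
  have h2 : ∀ Z : G → Option A, smallItems A' G' L Z i =
      univ.filter fun j => j ∈ G' \ L i ∧ Z j = some i := fun Z => by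
    rw [smallItems, if_pos hi]
    ext j
    simp
  simp only [h2]
  rw [h]
  refine multilinearExt_congr_arg fun j => ?_
  by_cases hj : j ∈ G' \ L i
  · simp only [hj, true_and, restrictTo, if_true, sum_filter]
    simp [assignWeight]
  · simp only [hj, false_and, restrictTo, if_false, filter_false, sum_empty]

/-- Markov's inequality. The mean of `F` is at most `a`, and `F > 2 a` outside of `E`. -/
lemma half_le_roundingProb {A' : Finset A} {G' : Finset G} (hy : LogFeasible A' G' y)
    {F : (G → Option A) → ℝ} (hF : ∀ Z, 0 ≤ F Z) {a : ℝ} (ha : 0 < a)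
    (hmean : prodExp (assignWeight y) F ≤ a) {E : (G → Option A) → Prop}
    (hE : ∀ Z, F Z ≤ 2 * a → E Z) : 1 / 2 ≤ roundingProb y E := by
  classical
  have h1 : roundingProb y E = prodExp (assignWeight y) fun Z => if E Z then 1 else 0 := by
    unfold roundingProb prodExp
    rw [sum_filter]
    exact sum_congr rfl fun Z _ => by by_cases h : E Z <;> simp [h]
  have h2 : prodExp (assignWeight y) (fun _ => 2 * a) ≤
      prodExp (assignWeight y) fun Z => 2 * a * (if E Z then 1 else 0) + F Z := by
    refine prodExp_mono (assignWeight_nonneg hy) fun Z => ?_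
    by_cases hZ : E Z
    · rw [if_pos hZ]; linarith [hF Z]
    · rw [if_neg hZ]; linarith [not_le.1 (mt (hE Z) hZ)]
  rw [prodExp_add, prodExp_const (sum_assignWeight y), prodExp_const_mul, ← h1] at h2
  nlinarith

/-- The rounding succeeds with probability at least `1/2` for each loss `b` that is at least the product
of the factors lost in the comparison with the relaxation and in the rounding step. -/
lemma half_le_roundingProb_existsMatchingAbove (hv : ∀ i, IsMonotoneSubmodular (v i))
    (hτ : IsOptimalMatching v τ) (hpos : ∀ i, 0 < v i {τ i})
    (hy : IteratedContinuousGreedy v (activeAgents v τ) (remainingItems τ) y)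
    {c : ℝ} (hc : 0 < c) {L : A → Finset G}
    (hL : ∀ i ∈ activeAgents v τ, IsLargeSet (v i) (remainingItems τ) (y i) c (L i))
    {b : ℝ} (hb : 4 * (1 + 2 * (14 + 8 / c + 2 * c)) ≤ b) :
    1 / 2 ≤ roundingProb y (fun Z => ExistsMatchingAbove v (matchedItems τ)
      (smallItems (activeAgents v τ) (remainingItems τ) L Z)
      (mixedOPT v (matchedItems τ) / b)) := by
  have hG : ∀ i ∈ activeAgents v τ, 0 < v i (remainingItems τ) := fun i hi => (mem_filter.1 hi).2
  obtain ⟨hfeas, hypos, hratio⟩ := hy.sum_ratio_le hv hG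
  have hVy : ∀ i ∈ activeAgents v τ, 0 < multilinearExt (v i) (y i) := fun i hi =>
    hfeas.ext_pos hv (hG i hi) (hypos i hi)
  choose g hg0 hg1 hg2 hg3 using fun i => (hv i).exists_singleton_bound (remainingItems τ)
  set D := 14 + 8 / c + 2 * c with hD
  have hDpos : 0 < D := by positivity
  set F : (G → Option A) → ℝ := fun Z => ∑ i ∈ activeAgents v τ, multilinearExt (v i) (y i) /
    max (v i (smallItems (activeAgents v τ) (remainingItems τ) L Z i)) (g i) with hF
  have hF0 : ∀ Z, 0 ≤ F Z := fun Z => sum_nonneg fun i hi =>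
    div_nonneg (hVy i hi).le (((hv i).nonneg _).trans (le_max_left _ _))
  have hmean : prodExp (assignWeight y) F ≤ D * Fintype.card A := by
    rw [hF, prodExp_sum]
    have h : ∀ i ∈ activeAgents v τ, prodExp (assignWeight y) (fun Z => multilinearExt (v i) (y i) /
        max (v i (smallItems (activeAgents v τ) (remainingItems τ) L Z i)) (g i)) ≤ D :=
      fun i hi => by
        rw [prodExp_smallItems y L hi fun S => multilinearExt (v i) (y i) / max (v i S) (g i)]
        exact ext_ratio_le (hv i) (hfeas.nonneg i) (hfeas.le_one i) (hfeas.eq_zero_of_item i) hc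
          (hL i hi) (hg3 i (hG i hi)) (hg0 i) (hg1 i)
    refine (sum_le_card_nsmul _ _ _ h).trans ?_
    rw [nsmul_eq_mul, mul_comm]
    gcongr
    exact card_le_univ _
  have hE : ∀ Z, F Z ≤ 2 * (D * Fintype.card A) → ExistsMatchingAbove v (matchedItems τ)
      (smallItems (activeAgents v τ) (remainingItems τ) L Z) (mixedOPT v (matchedItems τ) / b) :=
    fun Z hZ => existsMatchingAbove_of_forall hv (C := 4 * (1 + 2 * D)) (by positivity) hb
      fun x hx => exists_matching_geomMean_ge hv hτ hpos hratio hVy hg2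
        (fun i hi => hg3 i (hG i hi)) _ (by positivity) (by rw [mul_assoc]; exact hZ) hx
  -- Without agents the mean is `0`, which is not admissible as the bound in Markov's inequality.
  rcases isEmpty_or_nonempty A with hA | hA
  · refine half_le_roundingProb hfeas hF0 one_pos (hmean.trans (by simp)) fun Z _ => hE Z ?_
    simp [hF, Finset.eq_empty_of_isEmpty (activeAgents v τ)]
  · exact half_le_roundingProb hfeas hF0 (by positivity) hmean hE

end NashWelfare
end

open NashWelfare

theorem mainTheorem3 :
    ∃ p : ℝ, 0 < p ∧
      ∀ (A G : Type*) [Fintype A] [Fintype G] [DecidableEq A] [DecidableEq G]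
        (v : A → Finset G → ℝ) (_ : ∀ i, IsMonotoneSubmodular (v i))
        (τ : A → G) (_ : IsOptimalMatching v τ) (_ : ∀ i, 0 < v i {τ i})
        (y : A → G → ℝ)
        (_ : IteratedContinuousGreedy v (activeAgents v τ) (remainingItems τ) y)
        (c : ℝ) (_ : 0 < c)
        (L : A → Finset G)
        (_ : ∀ i ∈ activeAgents v τ, IsLargeSet (v i) (remainingItems τ) (y i) c (L i)),
        p ≤ roundingProb y (fun Z =>
            ExistsMatchingAbove v (matchedItems τ)
              (smallItems (activeAgents v τ) (remainingItems τ) L Z)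
              (mixedOPT v (matchedItems τ) / ((7 + 12 / c) * (c + 3) * (c + 4)))) ∧
        (c = 1 →
          p ≤ roundingProb y (fun Z =>
            ExistsMatchingAbove v (matchedItems τ)
              (smallItems (activeAgents v τ) (remainingItems τ) L Z)
              (mixedOPT v (matchedItems τ) / 380))) := by
  refine ⟨1 / 2, by norm_num, fun A G _ _ _ _ v hv τ hτ hpos y hy c hc L hL => ⟨?_, ?_⟩⟩
  · refine half_le_roundingProb_existsMatchingAbove hv hτ hpos hy hc hL ?_
    have h : (7 + 12 / c) * (c + 3) * (c + 4) = 7 * c ^ 2 + 61 * c + 168 + 18 * (8 / c) := by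
      field_simp
      ring
    have h8c : 0 < 8 / c := by positivity
    rw [h]
    nlinarith
  · rintro rfl
    exact half_le_roundingProb_existsMatchingAbove hv hτ hpos hy one_pos hL (by norm_num)
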